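/- Let $f:\mathbb N_0\to(0,\infty)$ be non-decreasing with $\sum_{i\ge0}1/f(i)=\infty$, put $\Phi_k(l)=\sum_{i=0}^{l-1}f(i)^{-k}$ for $k=1,2$ and $l\ge 0$, and assume $\Phi_2(\infty):=\lim_{l\to\infty}\Phi_2(l)<\infty$. Let $(m_i)_{i\ge1}$ be i.i.d. random variables with values in $\{1,2,\dots\}$, and let $s_0=0$, $s_n=m_1+\dots+m_n$. Random directed multigraphs $\mathcal G^*_k$ ($k\ge0$) with $k$ edges are built conditionally on the sequence $(m_i)_{i\ge1}$ as follows. $\mathcal G^*_0$ is the single vertex $v_0$. For $s_{n-1}<k\le s_n$, the vertices of $\mathcal G^*_k$ are $v_0,\dots,v_n$, and $\mathcal G^*_k$ arises from $\mathcal G^*_{k-1}$ by adding an edge directed from $v_n$ to one of $v_0,\dots,v_{n-1}$ (together with the vertex $v_n$ if $k=s_{n-1}+1$); given $(m_i)_{i\ge1}$ and $\mathcal G^*_0,\dots,\mathcal G^*_{k-1}$, the edge is attached to $v_i$, $0\le i\le n-1$, with probability $f(d_i(k-1))\big/\sum_{j=0}^{n-1}f(d_j(k-1))$, where $d_j(l)$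 is the degree (in-degree plus out-degree) of $v_j$ in $\mathcal G^*_l$. Let $\mathcal G_n=\mathcal G^*_{s_n}$. A persistent hub is said to emerge in a realization of a graph sequence $(G_n)_{n\ge0}$ if there are a vertex $v$ and a finite $n_0$ such that $v$ has maximal degree in $G_n$ (possibly tied) for all $n\ge n_0$. (i) Suppose that there is $C_f>0$ with $f(i)\le C_f(i+1)$ for all $i\ge0$, and that there are $D,z_0>0$ and $\theta>1$ with $\mathbb P(\Phi_1(m_1)>z)\le e^{-Dz^{\theta}}$ for all $z\ge z_0$. Then, almost surely, a persistent hub emerges, both in $(\mathcal G_n)_{n\ge0}$ and in $(\mathcal G^*_k)_{k\ge0}$. (ii) Suppose that $\mathbb E\,m_1<\infty$, and that there are $D',z_0'>0$ and $\theta'\in(0,1)$ with $\mathbb P(\Phi_1(m_1)>z)\ge e^{-D'z^{\theta'}}$ for all $z\ge z_0'$. Then, almost surely, no persistent hub emerges, neither in $(\mathcal G_n)_{n\ge0}$ nor in $(\mathcal G^*_k)_{k\ge0}$. -/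

import Mathlib

open MeasureTheory ProbabilityTheory Filter Topology

namespace AttachmentModel

/-- A finite directed multigraph on vertices labelled by natural numbers (`i` stands for the vertex
`v_i`). An edge is a pair `(tail, head)`: it is directed away from its tail. -/
structure MultiDigraph where
  vertices : Finset ℕ
  edges : Multiset (ℕ × ℕ)

/-- The degree of a vertex: the sum of its out-degree and its in-degree. -/
def MultiDigraph.degree (G : MultiDigraph) (v : ℕ) : ℕ :=
  G.edges.countP (fun e => e.1 = v) + G.edges.countP (fun e => e.2 = v)

/-- `v` is a vertex of `G` whose degree is maximal (ties are allowed). -/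
def MultiDigraph.HasMaxDegree (G : MultiDigraph) (v : ℕ) : Prop :=
  v ∈ G.vertices ∧ ∀ w ∈ G.vertices, G.degree w ≤ G.degree v

/-- In the graph sequence `G`, from some time on one and the same vertex has maximal degree. -/
def PersistentHub (G : ℕ → MultiDigraph) : Prop :=
  ∃ v n₀ : ℕ, ∀ n, n₀ ≤ n → (G n).HasMaxDegree v

/-- `s_n = m_1 + ⋯ + m_n`. The attachment sequence is indexed from `0`: `m i` is the number `m_{i+1}`
of edges with which the vertex `v_{i+1}` enters. -/
def edgeTotal (m : ℕ → ℕ) (n : ℕ) : ℕ := ∑ i ∈ Finset.range n, m i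

/-- The index of the youngest vertex when `k` edges are attached: the `n` with `s_{n-1} < k ≤ s_n`
if `k ≥ 1`, and `0` if `k = 0`. For `k ≥ 1` this is also the index of the tail of the `k`-th edge. -/
noncomputable def newest (m : ℕ → ℕ) (k : ℕ) : ℕ := sInf {n | k ≤ edgeTotal m n}

/-- The graph `G*_k` with `k` attached edges, for the attachment sequence `m` and the sequence `x` of
heads: `x j` is the index of the vertex to which the `(j+1)`-th edge is attached. -/
noncomputable def edgeGraph (m x : ℕ → ℕ) (k : ℕ) : MultiDigraph where
  vertices := Finset.range (newest m k + 1)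
  edges := (Multiset.range k).map (fun j => (newest m (j + 1), x j))

/-- The graph `G_n = G*_{s_n}`, just after `v_n` has attached all of its edges. -/
noncomputable def vertexGraph (m x : ℕ → ℕ) (n : ℕ) : MultiDigraph :=
  edgeGraph m x (edgeTotal m n)

/-- The conditional probability that the `(k+1)`-th edge is attached to `v_i`: with `v_n` its tail,
`f (d_i(k)) / ∑_{j < n} f (d_j(k))` for `i < n`, where `d_j(k)` is the degree of `v_j` when `k` edges
are attached. -/
noncomputable def attachProb (f : ℕ → ℝ) (m x : ℕ → ℕ) (k i : ℕ) : ℝ :=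
  if i < newest m (k + 1) then
    f ((edgeGraph m x k).degree i) /
      ∑ j ∈ Finset.range (newest m (k + 1)), f ((edgeGraph m x k).degree j)
  else 0

/-- The information before the `(k+1)`-th edge is attached: the whole attachment sequence (on which
the recipe is conditional), and the heads of the first `k` edges. -/
@[reducible] def history {Ω : Type*} (m X : ℕ → Ω → ℕ) (k : ℕ) : MeasurableSpace Ω :=
  (⨆ i, MeasurableSpace.comap (m i) inferInstance) ⊔
    ⨆ j, ⨆ _ : j < k, MeasurableSpace.comap (X j) inferInstance

/-- The random heads `X` and the random attachment sequence `m`, defined on a common probability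
space, form a generalized attachment model with attachment function `f`. The
last field says that, given the attachment sequence, edges are attached one after the other, each
to an older vertex chosen with probability proportional to `f` of its current degree. -/
structure IsAttachmentModel {Ω : Type*} [MeasurableSpace Ω] (μ : Measure Ω) (f : ℕ → ℝ)
    (m X : ℕ → Ω → ℕ) : Prop where
  measurable_m : ∀ i, Measurable (m i)
  one_le_m : ∀ i ω, 1 ≤ m i ω
  measurable_X : ∀ k, Measurable (X k)
  condProb_attach : ∀ k i,
    μ[Set.indicator {ω | X k ω = i} (fun _ => (1 : ℝ)) | history m X k]
      =ᵐ[μ] fun ω => attachProb f (fun l => m l ω) (fun l => X l ω) k i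

/-- `Φ_k(l) = ∑_{i=0}^{l-1} 1 / f(i)^k`. -/
noncomputable def Phi (f : ℕ → ℝ) (k l : ℕ) : ℝ := ∑ i ∈ Finset.range l, 1 / f i ^ k

end AttachmentModel

/-!
Write `S(l)` for the sum of `f` over the degrees of the possible heads of the `(l+1)`-th edge. This
edge is attached to `v` with probability `f (d_v(l)) / S(l)`, and `Φ₁(d_v)` then grows by
`1 / f (d_v(l))`. So the conditional mean growth of `Φ₁(d_v)` is `1 / S(l)`, the same for all
vertices: `Φ₁(d_v)` minus the common clock `A(k) = ∑_{l < k} 1 / S(l)` is a martingale once `v` has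
attached its own edges. Its quadratic variation is bounded by `Φ₂(∞) < ∞`, whence it converges
(`ae_tendsto_fluct`). Everything is thus decided by comparing the value `Φ₁(m_n)`, with which `v_n`
starts, to the clock `A(s_n)` at that time.

*No hub.* As `f` is bounded below and `𝔼 m_1 < ∞`, the law of large numbers gives
`A(s_n) = O(log n)`. With a stretched exponential lower tail of exponent below `1`, the second
Borel-Cantelli lemma gives `Φ₁(m_n) > C log n` infinitely often, for every `C`. So each vertex is
overtaken infinitely often by a vertex that has just been born (`ae_not_persistentHub`).

*A hub.* As `f` grows at most linearly, `A(s_n) ≥ c log n`, whereas `Φ₁(m_n) ≤ (c / 4) log n`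
eventually. To overtake `v_0`, the vertex `v_n` would need a fluctuation of order `log n`. The
product martingale `expFluct`, together with Doob's maximal inequality, shows that this has
probability at most of order `n⁻²` (`ae_eventually_fluct_le`), so only finitely many vertices ever
lead. It remains to see that two vertices do not exchange the lead infinitely often, that is, that
the limit of `D = Φ₁(d_i) - Φ₁(d_j)` does not vanish. Let `v` be the quadratic variation of `D` still
to come, `v = ∑_{a ≥ d_i} f(a)⁻² + ∑_{b ≥ d_j} f(b)⁻²`. Then `G = D² + v` is a martingale and
`D⁴ + 10 D² v + 17 v²` is a supermartingale that lies between `G²` and `17 G²`. At any time, this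
second moment bound leaves a conditional probability of at least `1 / 17` that `G` does not tend to
`0`, and Lévy's zero-one law then excludes `G → 0` (`ae_not_tendsto_zero_of_sq_le`). As `v → 0`, the
limit of `D` is not `0`.
-/

namespace AttachmentModel

/-! ### Combinatorics of the attachment mechanism -/

/-- The degree `d_v(k)` of the vertex `v` once `k` edges are attached. -/
noncomputable abbrev deg (m x : ℕ → ℕ) (v k : ℕ) : ℕ := (edgeGraph m x k).degree v

/-- The normalizing sum `∑_{j < n} f (d_j(k))` in the attachment probability of the `(k+1)`-th
edge, where `v_n` is the tail of that edge. -/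
noncomputable def totalWeight (f : ℕ → ℝ) (m x : ℕ → ℕ) (k : ℕ) : ℝ :=
  ∑ j ∈ Finset.range (newest m (k + 1)), f (deg m x j k)

/-- The sum over the first `k` edges of the inverse total weight. The conditional mean increase of
`Φ₁` of the degree of any vertex present equals the increase of this common clock. -/
noncomputable def clock (f : ℕ → ℝ) (m x : ℕ → ℕ) (k : ℕ) : ℝ :=
  ∑ l ∈ Finset.range k, 1 / totalWeight f m x l

/-- The compensated process `Φ₁(d_v) - clock`, started at `0` when `v` has attached its edges. -/
noncomputable def fluct (f : ℕ → ℝ) (m x : ℕ → ℕ) (v k : ℕ) : ℝ :=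
  ∑ l ∈ Finset.range k, if edgeTotal m v ≤ l then
    (if x l = v then 1 / f (deg m x v l) else 0) - 1 / totalWeight f m x l else 0

/-- The product martingale, with parameter `c`, that controls the upper tail of `fluct`. Each edge
after the birth of `v` contributes a factor, `1 + c / f (d_v)` if it is attached to `v` and `1`
otherwise, divided by the conditional mean of that factor. -/
noncomputable def expFluct (f : ℕ → ℝ) (c : ℝ) (m x : ℕ → ℕ) (v k : ℕ) : ℝ :=
  ∏ l ∈ Finset.range k, if edgeTotal m v ≤ l then
    (if x l = v then 1 + c / f (deg m x v l) else 1) / (1 + c / totalWeight f m x l) else 1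

section Deterministic

variable {f : ℕ → ℝ} {m x : ℕ → ℕ}

lemma edgeTotal_succ (m : ℕ → ℕ) (n : ℕ) : edgeTotal m (n + 1) = edgeTotal m n + m n :=
  Finset.sum_range_succ _ _

lemma edgeTotal_zero (m : ℕ → ℕ) : edgeTotal m 0 = 0 := rfl

lemma edgeTotal_mono (m : ℕ → ℕ) : Monotone (edgeTotal m) :=
  monotone_nat_of_le_succ fun n => by rw [edgeTotal_succ]; omega

lemma le_edgeTotal (hm : ∀ i, 1 ≤ m i) (n : ℕ) : n ≤ edgeTotal m n := by
  induction n with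
  | zero => simp
  | succ n ih => rw [edgeTotal_succ]; have := hm n; omega

lemma newest_le_iff (hm : ∀ i, 1 ≤ m i) {k n : ℕ} : newest m k ≤ n ↔ k ≤ edgeTotal m n := by
  have hne : {n | k ≤ edgeTotal m n}.Nonempty := ⟨k, le_edgeTotal hm k⟩
  constructor
  · intro h
    have h' : k ≤ edgeTotal m (newest m k) := Nat.sInf_mem hne
    exact h'.trans (edgeTotal_mono m h)
  · intro h
    exact Nat.sInf_le h

lemma lt_newest_iff (hm : ∀ i, 1 ≤ m i) {k n : ℕ} : n < newest m k ↔ edgeTotal m n < k := by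
  rw [← not_le, newest_le_iff hm, not_le]

lemma newest_succ_pos (hm : ∀ i, 1 ≤ m i) (k : ℕ) : 0 < newest m (k + 1) := by
  rw [lt_newest_iff hm, edgeTotal_zero]; omega

lemma newest_le (hm : ∀ i, 1 ≤ m i) (k : ℕ) : newest m k ≤ k :=
  (newest_le_iff hm).2 (le_edgeTotal hm k)

lemma newest_edgeTotal (hm : ∀ i, 1 ≤ m i) (n : ℕ) : newest m (edgeTotal m n) = n := by
  refine le_antisymm ((newest_le_iff hm).2 le_rfl) ?_
  cases n with
  | zero => simp
  | succ n =>
    rw [Nat.succ_le_iff, lt_newest_iff hm, edgeTotal_succ]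
    have := hm n; omega

lemma deg_zero (m x : ℕ → ℕ) (v : ℕ) : deg m x v 0 = 0 := by
  simp [deg, edgeGraph, MultiDigraph.degree]

lemma deg_succ (m x : ℕ → ℕ) (v k : ℕ) : deg m x v (k + 1) =
    deg m x v k + (if newest m (k + 1) = v then 1 else 0) + (if x k = v then 1 else 0) := by
  simp only [deg, edgeGraph, MultiDigraph.degree, Multiset.range_succ, Multiset.map_cons,
    Multiset.countP_cons]
  omega

lemma deg_mono (m x : ℕ → ℕ) (v : ℕ) : Monotone (deg m x v) :=
  monotone_nat_of_le_succ fun k => by rw [deg_succ]; omega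

lemma sum_deg_le (m x : ℕ → ℕ) (s : Finset ℕ) (k : ℕ) : ∑ v ∈ s, deg m x v k ≤ 2 * k := by
  induction k with
  | zero => simp [deg_zero]
  | succ k ih =>
    simp only [deg_succ, Finset.sum_add_distrib, Finset.sum_ite_eq]
    split_ifs <;> omega

lemma deg_le (m x : ℕ → ℕ) (v k : ℕ) : deg m x v k ≤ 2 * k := by
  simpa using sum_deg_le m x {v} k

lemma deg_succ_of_le (hm : ∀ i, 1 ≤ m i) {v k : ℕ} (hk : edgeTotal m v ≤ k) :
    deg m x v (k + 1) = deg m x v k + (if x k = v then 1 else 0) := by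
  have : v < newest m (k + 1) := (lt_newest_iff hm).2 (by omega)
  rw [deg_succ, if_neg this.ne', add_zero]

/-- While `v_{n+1}` attaches its edges, its degree counts the edges attached so far. -/
lemma deg_young (hm : ∀ i, 1 ≤ m i) (hx : ∀ k, x k < newest m (k + 1)) (n : ℕ) {k : ℕ}
    (hk : k ≤ edgeTotal m (n + 1)) : deg m x (n + 1) k = k - edgeTotal m n := by
  induction k with
  | zero => simp [deg_zero]
  | succ k ih =>
    have h1 : newest m (k + 1) ≤ n + 1 := (newest_le_iff hm).2 hk
    have h2 := hx k
    have h3 : newest m (k + 1) ≤ n ↔ k + 1 ≤ edgeTotal m n := newest_le_iff hm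
    rw [deg_succ, ih (by omega), if_neg (by omega : ¬ x k = n + 1)]
    split_ifs <;> omega

lemma deg_newborn (hm : ∀ i, 1 ≤ m i) (hx : ∀ k, x k < newest m (k + 1)) (n : ℕ) :
    deg m x (n + 1) (edgeTotal m (n + 1)) = m n := by
  rw [deg_young hm hx n le_rfl, edgeTotal_succ]; omega

lemma Phi_succ (f : ℕ → ℝ) (p l : ℕ) : Phi f p (l + 1) = Phi f p l + 1 / f l ^ p :=
  Finset.sum_range_succ _ _

lemma Phi_strictMono (hf : ∀ i, 0 < f i) (p : ℕ) : StrictMono (Phi f p) :=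
  strictMono_nat_of_lt_succ fun l => by
    rw [Phi_succ]; have := hf l; have : 0 < 1 / f l ^ p := by positivity
    linarith

lemma Phi_zero (f : ℕ → ℝ) (p : ℕ) : Phi f p 0 = 0 := rfl

lemma Phi_nonneg (hf : ∀ i, 0 < f i) (p l : ℕ) : 0 ≤ Phi f p l := by
  rw [← Phi_zero f p]; exact (Phi_strictMono hf p).monotone (Nat.zero_le l)

lemma Phi_le_limit (hf : ∀ i, 0 < f i) {p : ℕ} {L : ℝ} (hL : Tendsto (Phi f p) atTop (𝓝 L))
    (l : ℕ) : Phi f p l ≤ L :=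
  (Phi_strictMono hf p).monotone.ge_of_tendsto hL l

lemma mul_le_totalWeight (hf_mono : Monotone f) (m x : ℕ → ℕ) (k : ℕ) :
    newest m (k + 1) * f 0 ≤ totalWeight f m x k := by
  calc (newest m (k + 1) : ℝ) * f 0 = ∑ _j ∈ Finset.range (newest m (k + 1)), f 0 := by simp
    _ ≤ _ := Finset.sum_le_sum fun j _ => hf_mono (Nat.zero_le _)

lemma zero_le_totalWeight (hf : ∀ i, 0 < f i) (m x : ℕ → ℕ) (k : ℕ) :
    0 ≤ totalWeight f m x k := Finset.sum_nonneg fun _ _ => (hf _).le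

lemma le_totalWeight (hf : ∀ i, 0 < f i) (hf_mono : Monotone f) (hm : ∀ i, 1 ≤ m i) (k : ℕ) :
    f 0 ≤ totalWeight f m x k := by
  refine le_trans ?_ (mul_le_totalWeight hf_mono m x k)
  have : (1 : ℝ) ≤ newest m (k + 1) := by exact_mod_cast newest_succ_pos hm k
  nlinarith [hf 0]

lemma totalWeight_pos (hf : ∀ i, 0 < f i) (hf_mono : Monotone f) (hm : ∀ i, 1 ≤ m i) (k : ℕ) :
    0 < totalWeight f m x k := (hf 0).trans_le (le_totalWeight hf hf_mono hm k)

lemma inv_totalWeight_mem (hf : ∀ i, 0 < f i) (hf_mono : Monotone f) {m x : ℕ → ℕ}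
    (hm : ∀ i, 1 ≤ m i) (k : ℕ) :
    0 < 1 / totalWeight f m x k ∧ 1 / totalWeight f m x k ≤ 1 / f 0 :=
  ⟨one_div_pos.2 (totalWeight_pos hf hf_mono hm k),
    one_div_le_one_div_of_le (hf 0) (le_totalWeight hf hf_mono hm k)⟩

lemma inv_f_mem (hf : ∀ i, 0 < f i) (hf_mono : Monotone f) (d : ℕ) :
    0 < 1 / f d ∧ 1 / f d ≤ 1 / f 0 :=
  ⟨one_div_pos.2 (hf d), one_div_le_one_div_of_le (hf 0) (hf_mono (Nat.zero_le d))⟩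

lemma clock_succ (f : ℕ → ℝ) (m x : ℕ → ℕ) (k : ℕ) :
    clock f m x (k + 1) = clock f m x k + 1 / totalWeight f m x k :=
  Finset.sum_range_succ _ _

lemma clock_mono (hf : ∀ i, 0 < f i) (m x : ℕ → ℕ) : Monotone (clock f m x) :=
  monotone_nat_of_le_succ fun k => by
    rw [clock_succ]
    have := zero_le_totalWeight hf m x k
    have : 0 ≤ 1 / totalWeight f m x k := by positivity
    linarith

lemma fluct_succ (f : ℕ → ℝ) (m x : ℕ → ℕ) (v k : ℕ) : fluct f m x v (k + 1) = fluct f m x v k +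
    if edgeTotal m v ≤ k then
      (if x k = v then 1 / f (deg m x v k) else 0) - 1 / totalWeight f m x k else 0 :=
  Finset.sum_range_succ _ _

lemma fluct_eq_zero {v k : ℕ} (h : k ≤ edgeTotal m v) : fluct f m x v k = 0 := by
  refine Finset.sum_eq_zero fun l hl => if_neg ?_
  rw [Finset.mem_range] at hl; omega

lemma Phi_deg (hm : ∀ i, 1 ≤ m i) {v k : ℕ} (hk : edgeTotal m v ≤ k) :
    Phi f 1 (deg m x v k) = Phi f 1 (deg m x v (edgeTotal m v)) +
      (clock f m x k - clock f m x (edgeTotal m v)) + fluct f m x v k := by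
  induction k, hk using Nat.le_induction with
  | base => rw [fluct_eq_zero le_rfl]; ring
  | succ k hk ih =>
    rw [deg_succ_of_le hm hk, clock_succ, fluct_succ, if_pos hk]
    split_ifs
    · rw [Phi_succ, ih]; ring
    · rw [add_zero, ih]; ring

lemma expFluct_succ (f : ℕ → ℝ) (c : ℝ) (m x : ℕ → ℕ) (v k : ℕ) :
    expFluct f c m x v (k + 1) = expFluct f c m x v k * if edgeTotal m v ≤ k then
      (if x k = v then 1 + c / f (deg m x v k) else 1) / (1 + c / totalWeight f m x k) else 1 :=
  Finset.prod_range_succ _ _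

lemma expFluct_pos (hf : ∀ i, 0 < f i) {c : ℝ} (hc : 0 < c) (m x : ℕ → ℕ) (v k : ℕ) :
    0 < expFluct f c m x v k := by
  refine Finset.prod_pos fun l _ => ?_
  have h1 := hf (deg m x v l)
  have h2 := zero_le_totalWeight hf m x l
  split_ifs <;> positivity

lemma expFluct_le (hf : ∀ i, 0 < f i) (hf_mono : Monotone f) {c : ℝ} (hc : 0 < c)
    (m x : ℕ → ℕ) (v k : ℕ) :
    expFluct f c m x v k ≤ (1 + c / f 0) ^ k := by
  have h0 := hf 0
  rw [← Finset.card_range k, ← Finset.prod_const, Finset.card_range]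
  refine Finset.prod_le_prod (fun l _ => ?_) fun l _ => ?_
  · have h1 := hf (deg m x v l)
    have h2 := zero_le_totalWeight hf m x l
    split_ifs <;> positivity
  · have h1 := hf (deg m x v l)
    have h2 := zero_le_totalWeight hf m x l
    have h3 : c / f (deg m x v l) ≤ c / f 0 := by gcongr; exact hf_mono (Nat.zero_le _)
    have h4 : 0 ≤ c / totalWeight f m x l := by positivity
    have h5 : 0 ≤ c / f 0 := by positivity
    split_ifs
    · rw [div_le_iff₀ (by positivity)]; nlinarith
    · rw [div_le_iff₀ (by positivity)]; nlinarith
    · linarith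

/-- `log (1 + u) ≥ u - u² / 2` turns the product martingale into an exponential one whose
compensator is the bounded quantity `Φ₂` of the degree. -/
lemma fluct_le_log_expFluct (hf : ∀ i, 0 < f i) {c : ℝ} (hc : 0 < c) (m x : ℕ → ℕ) (v k : ℕ) :
    c * fluct f m x v k ≤ Real.log (expFluct f c m x v k) + c ^ 2 / 2 * Phi f 2 (deg m x v k) := by
  induction k with
  | zero => simp [fluct, expFluct, deg_zero, Phi]
  | succ k ih =>
    have hP : Phi f 2 (deg m x v k) ≤ Phi f 2 (deg m x v (k + 1)) :=
      (Phi_strictMono hf 2).monotone (deg_mono m x v (Nat.le_succ k))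
    have h1 := hf (deg m x v k)
    have h2 := zero_le_totalWeight hf m x k
    have hlogS : Real.log (1 + c / totalWeight f m x k) ≤ c / totalWeight f m x k := by
      have := Real.log_le_sub_one_of_pos (x := 1 + c / totalWeight f m x k) (by positivity)
      linarith
    rw [fluct_succ, expFluct_succ, Real.log_mul (expFluct_pos hf hc m x v k).ne'
      (by split_ifs <;> positivity)]
    have hc2 : 0 ≤ c ^ 2 / 2 := by positivity
    have hP' := mul_le_mul_of_nonneg_left hP hc2
    by_cases hk : edgeTotal m v ≤ k
    · simp only [if_pos hk]
      by_cases hx : x k = v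
      · simp only [if_pos hx]
        have hP2 : Phi f 2 (deg m x v k) + 1 / f (deg m x v k) ^ 2 ≤
            Phi f 2 (deg m x v (k + 1)) := by
          rw [← Phi_succ]
          refine (Phi_strictMono hf 2).monotone ?_
          rw [deg_succ, if_pos hx]; omega
        have hP2' := mul_le_mul_of_nonneg_left hP2 hc2
        rw [Real.log_div (by positivity) (by positivity)]
        have hlog : c / f (deg m x v k) - (c / f (deg m x v k)) ^ 2 / 2 ≤
            Real.log (1 + c / f (deg m x v k)) := by
          set u := c / f (deg m x v k)
          have hu : 0 ≤ u := by positivity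
          refine le_trans ?_ (Real.le_log_one_add_of_nonneg hu)
          rw [le_div_iff₀ (by positivity)]
          nlinarith [pow_nonneg hu 3]
        have e1 : c * (1 / f (deg m x v k) - 1 / totalWeight f m x k) =
          c / f (deg m x v k) - c / totalWeight f m x k := by ring
        have e2 : (c / f (deg m x v k)) ^ 2 / 2 = c ^ 2 / 2 * (1 / f (deg m x v k) ^ 2) := by
          ring
        rw [mul_add, e1]
        rw [e2] at hlog
        linarith
      · simp only [if_neg hx]
        rw [Real.log_div one_ne_zero (by positivity), Real.log_one]
        have e1 : c * (0 - 1 / totalWeight f m x k) = - (c / totalWeight f m x k) := by ring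
        rw [mul_add, e1]
        linarith
    · simp only [if_neg hk, add_zero, Real.log_one]
      linarith

lemma abs_fluct_le (hf : ∀ i, 0 < f i) (hf_mono : Monotone f) (hm : ∀ i, 1 ≤ m i) (v k : ℕ) :
    |fluct f m x v k| ≤ k * (1 / f 0) := by
  have h0 := hf 0
  induction k with
  | zero => simp [fluct]
  | succ k ih =>
    rw [fluct_succ]
    refine (abs_add_le _ _).trans ?_
    push_cast
    rw [add_mul, one_mul]
    refine add_le_add ih ?_
    have h1 := hf (deg m x v k)
    have hS := totalWeight_pos (x := x) hf hf_mono hm k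
    have h2 : 1 / totalWeight f m x k ≤ 1 / f 0 := by
      gcongr; exact le_totalWeight hf hf_mono hm k
    have h3 : 1 / f (deg m x v k) ≤ 1 / f 0 := by gcongr; exact hf_mono (Nat.zero_le _)
    have h4 : 0 < 1 / totalWeight f m x k := by positivity
    have h5 : 0 < 1 / f (deg m x v k) := by positivity
    have h6 : 0 < 1 / f 0 := by positivity
    split_ifs
    · rw [abs_le]; constructor <;> linarith
    · rw [abs_le]; constructor <;> linarith
    · rw [abs_zero]; exact h6.le

/-- If `f` grows at most linearly, then the clock runs at least logarithmically in the number of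
edges. -/
lemma log_le_clock (hf : ∀ i, 0 < f i) (hf_mono : Monotone f) (hm : ∀ i, 1 ≤ m i) {Cf : ℝ}
    (hCf : 0 < Cf) (hlin : ∀ i : ℕ, f i ≤ Cf * ((i : ℝ) + 1)) (k : ℕ) :
    1 / (3 * Cf) * Real.log (k + 1) ≤ clock f m x k := by
  have hS : ∀ l, totalWeight f m x l ≤ 3 * Cf * (l + 1) := fun l => by
    calc totalWeight f m x l
        ≤ ∑ j ∈ Finset.range (newest m (l + 1)), Cf * ((deg m x j l : ℝ) + 1) :=
          Finset.sum_le_sum fun j _ => hlin _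
      _ = Cf * (((∑ j ∈ Finset.range (newest m (l + 1)), deg m x j l : ℕ) : ℝ) +
            (newest m (l + 1) : ℕ)) := by
          rw [← Finset.mul_sum, Finset.sum_add_distrib]; simp
      _ ≤ Cf * (((2 * l : ℕ) : ℝ) + (l + 1 : ℕ)) := by
          gcongr
          · exact sum_deg_le m x _ l
          · exact newest_le hm _
      _ ≤ 3 * Cf * (l + 1) := by push_cast; nlinarith
  have h1 : 1 / (3 * Cf) * (harmonic k : ℝ) ≤ clock f m x k := by
    rw [harmonic, clock]
    push_cast
    rw [Finset.mul_sum]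
    refine Finset.sum_le_sum fun l _ => ?_
    have := totalWeight_pos (x := x) hf hf_mono hm l
    rw [← one_div, one_div_mul_one_div]
    exact one_div_le_one_div_of_le this (hS l)
  refine le_trans ?_ h1
  have := log_add_one_le_harmonic k
  push_cast at this
  gcongr

lemma clock_edgeTotal_le (hf : ∀ i, 0 < f i) (hf_mono : Monotone f) (hm : ∀ i, 1 ≤ m i) (n : ℕ) :
    clock f m x (edgeTotal m n) ≤ 1 / f 0 * ∑ i ∈ Finset.range n, (m i : ℝ) / (i + 1) := by
  have h0 := hf 0
  induction n with
  | zero => simp [edgeTotal_zero, clock]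
  | succ n ih =>
    have key : ∀ j, j ≤ m n → clock f m x (edgeTotal m n + j) ≤
        clock f m x (edgeTotal m n) + j * (1 / ((n + 1) * f 0)) := by
      intro j hj
      induction j with
      | zero => simp
      | succ j ihj =>
        rw [← add_assoc, clock_succ]
        have hn : n < newest m (edgeTotal m n + j + 1) := (lt_newest_iff hm).2 (by omega)
        have hn' : ((n : ℝ) + 1) ≤ newest m (edgeTotal m n + j + 1) := by exact_mod_cast hn
        have hS : ((n : ℝ) + 1) * f 0 ≤ totalWeight f m x (edgeTotal m n + j) :=
          le_trans (by gcongr) (mul_le_totalWeight hf_mono m x _)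
        have := one_div_le_one_div_of_le (by positivity) hS
        have := ihj (by omega)
        push_cast
        linarith
    rw [edgeTotal_succ, Finset.sum_range_succ, mul_add]
    refine (key (m n) le_rfl).trans (add_le_add ih (le_of_eq ?_))
    field_simp

/-- Summation by parts: if `s_n ≤ K n`, then `∑_{i<n} m_i / (i+1)` is at most logarithmic. -/
lemma sum_div_le_log {K : ℝ} (hK : 0 ≤ K) (hs : ∀ n : ℕ, (edgeTotal m n : ℝ) ≤ K * n) (n : ℕ) :
    ∑ i ∈ Finset.range n, (m i : ℝ) / (i + 1) ≤ K * (2 + Real.log n) := by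
  have h1 : ∀ n : ℕ, ∑ i ∈ Finset.range n, (m i : ℝ) / (i + 1) ≤
      edgeTotal m n / (n + 1) + K * harmonic n := by
    intro n
    induction n with
    | zero => simp [edgeTotal_zero]
    | succ n ih =>
      rw [Finset.sum_range_succ, harmonic_succ]
      have hs1 := hs (n + 1)
      have e : (m n : ℝ) = edgeTotal m (n + 1) - edgeTotal m n := by
        rw [edgeTotal_succ]; push_cast; ring
      rw [e]
      push_cast at hs1 ⊢
      set s' : ℝ := ((edgeTotal m (n + 1) : ℕ) : ℝ)
      have hs0 : 0 ≤ s' := Nat.cast_nonneg _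
      have h2 : s' / (n + 1) ≤ s' / (n + 1 + 1) + K * ((n : ℝ) + 1)⁻¹ := by
        have : s' / (n + 1) - s' / (n + 1 + 1) = s' / ((n + 1) * (n + 1 + 1)) := by
          field_simp; ring
        have h3 : s' / ((n + 1) * (n + 1 + 1)) ≤ K * ((n : ℝ) + 1)⁻¹ := by
          rw [div_le_iff₀ (by positivity)]
          have : K * ((n : ℝ) + 1)⁻¹ * ((n + 1) * (n + 1 + 1)) = K * (n + 1 + 1) := by
            field_simp
          rw [this]; nlinarith
        linarith
      have : (s' - edgeTotal m n) / (n + 1) = s' / (n + 1) - edgeTotal m n / ((n : ℝ) + 1) := by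
        ring
      linarith
  refine (h1 n).trans ?_
  have h2 : (edgeTotal m n : ℝ) / (n + 1) ≤ K := by
    rw [div_le_iff₀ (by positivity)]; nlinarith [hs n]
  have h3 := mul_le_mul_of_nonneg_left (harmonic_le_one_add_log n) hK
  linarith

lemma PersistentHub.vertexGraph (hm : ∀ i, 1 ≤ m i) (h : PersistentHub (edgeGraph m x)) :
    PersistentHub (vertexGraph m x) := by
  obtain ⟨v, n₀, h⟩ := h
  exact ⟨v, n₀, fun n hn => h _ (hn.trans (le_edgeTotal hm n))⟩

end Deterministic

/-! ### Tools from martingale theory -/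

section Martingale

variable {Ω : Type*} {mΩ : MeasurableSpace Ω} {μ : Measure Ω} [IsProbabilityMeasure μ]
  {ℱ : Filtration ℕ mΩ}

lemma ae_exists_tendsto_of_integral_sq_le {M : ℕ → Ω → ℝ} (hM : Martingale M ℱ μ)
    (hsq : ∀ k, Integrable (fun ω => M k ω ^ 2) μ) {L : ℝ} (hL : ∀ k, ∫ ω, M k ω ^ 2 ∂μ ≤ L) :
    ∀ᵐ ω ∂μ, ∃ c, Tendsto (fun k => M k ω) atTop (𝓝 c) := by
  have hbdd : ∀ k, eLpNorm (M k) 1 μ ≤ ((1 + L).toNNReal : ENNReal) := fun k => by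
    rw [eLpNorm_one_eq_lintegral_enorm, ← ofReal_integral_norm_eq_lintegral_enorm (hM.integrable k)]
    refine ENNReal.ofReal_le_ofReal ?_
    calc ∫ ω, ‖M k ω‖ ∂μ ≤ ∫ ω, (1 + M k ω ^ 2) ∂μ := by
          refine integral_mono (hM.integrable k).norm ((integrable_const _).add (hsq k)) fun ω => ?_
          simp only [Real.norm_eq_abs]
          nlinarith [sq_nonneg (|M k ω| - 1), sq_abs (M k ω)]
      _ = 1 + ∫ ω, M k ω ^ 2 ∂μ := by rw [integral_add (integrable_const _) (hsq k)]; simp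
      _ ≤ 1 + L := by linarith [hL k]
  filter_upwards [hM.submartingale.ae_tendsto_limitProcess hbdd] with ω hω
  exact ⟨_, hω⟩

/-- Doob's maximal inequality over an infinite time horizon. -/
lemma measure_exists_le_martingale {M : ℕ → Ω → ℝ} (hM : Martingale M ℱ μ)
    (hpos : ∀ k ω, 0 ≤ M k ω) (h0 : ∀ ω, M 0 ω = 1) {a : ℝ} (ha : 0 < a) :
    μ {ω | ∃ k, a ≤ M k ω} ≤ ENNReal.ofReal (1 / a) := by
  set S : ℕ → Set Ω := fun n => {ω | ∃ k ≤ n, a ≤ M k ω}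
  have hU : {ω | ∃ k, a ≤ M k ω} = ⋃ n, S n := by
    ext ω
    simp only [Set.mem_ofPred_eq, Set.mem_iUnion, S]
    exact ⟨fun ⟨k, hk⟩ => ⟨k, k, le_rfl, hk⟩, fun ⟨_, k, _, hk⟩ => ⟨k, hk⟩⟩
  have hmono : Monotone S := fun n n' hn ω ⟨k, hk, h⟩ => ⟨k, hk.trans hn, h⟩
  rw [hU, hmono.measure_iUnion]
  refine iSup_le fun n => ?_
  have hmax := maximal_ineq hM.submartingale hpos (ε := a.toNNReal) n
  have hset : {ω | (a.toNNReal : ℝ) ≤ (Finset.range (n + 1)).sup' Finset.nonempty_range_add_one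
      fun k => M k ω} = S n := by
    ext ω
    simp only [Set.mem_ofPred_eq, Finset.le_sup'_iff, Finset.mem_range, S, Real.coe_toNNReal a ha.le,
      Nat.lt_succ_iff]
  rw [hset] at hmax
  have hint : ∫ ω in S n, M n ω ∂μ ≤ 1 := by
    calc ∫ ω in S n, M n ω ∂μ ≤ ∫ ω, M n ω ∂μ :=
          setIntegral_le_integral (hM.integrable n) (Eventually.of_forall (hpos n))
      _ = ∫ ω, M 0 ω ∂μ := by
          have := hM.setIntegral_eq (Nat.zero_le n) MeasurableSet.univ
          simpa using this.symm
      _ = 1 := by simp [h0]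
  have h1 : ENNReal.ofReal a * μ (S n) ≤ 1 := by
    refine hmax.trans ?_
    rw [← ENNReal.ofReal_one]
    exact ENNReal.ofReal_le_ofReal hint
  rw [ENNReal.ofReal_div_of_pos ha, ENNReal.ofReal_one, ENNReal.le_div_iff_mul_le
    (Or.inl (by simpa using ha)) (Or.inl ENNReal.ofReal_ne_top), mul_comm]
  exact h1

/-- A positive martingale whose conditional second moments are comparable to the square of its
present value does not tend to `0`. By a second moment bound the conditional probability
of converging to `0` is at most `1 - 1 / C` at every time, whereas by Lévy's zero-one law it tends
to `1` on the event itself. -/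
theorem ae_not_tendsto_zero_of_sq_le {G F : ℕ → Ω → ℝ} {C : ℝ} (hC : 0 < C)
    (hG : Martingale G ℱ μ) (hpos : ∀ k ω, 0 < G k ω) (hF : Supermartingale F ℱ μ)
    (hGF : ∀ k ω, G k ω ^ 2 ≤ F k ω) (hFG : ∀ k ω, F k ω ≤ C * G k ω ^ 2)
    (hbdd : ∀ k, ∃ B, ∀ ω, G k ω ≤ B) :
    ∀ᵐ ω ∂μ, ¬ Tendsto (fun k => G k ω) atTop (𝓝 0) := by
  classical
  set N : Set Ω := {ω | Tendsto (fun k => G k ω) atTop (𝓝 0)} with hN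
  have hle : (⨆ n, ℱ n) ≤ mΩ := iSup_le fun n => ℱ.le n
  have hNmeas : MeasurableSet[⨆ n, ℱ n] N :=
    measurableSet_tendsto (𝓝 0) fun k =>
      ((hG.stronglyMeasurable k).mono (le_iSup (fun n => ℱ n) k)).measurable
  have hGsm : ∀ k, StronglyMeasurable (G k) := fun k => (hG.stronglyMeasurable k).mono (ℱ.le k)
  choose B hB using hbdd
  have hB0 : ∀ k ω, |G k ω| ≤ B k := fun k ω => by rw [abs_of_pos (hpos k ω)]; exact hB k ω
  have hGG : ∀ k l, Integrable (fun ω => G k ω * G l ω) μ := fun k l =>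
    Integrable.of_bound ((hGsm k).mul (hGsm l)).aestronglyMeasurable (B k * B l)
      (Eventually.of_forall fun ω => by
        rw [Real.norm_eq_abs, abs_mul]
        exact mul_le_mul (hB0 k ω) (hB0 l ω) (abs_nonneg _) ((abs_nonneg _).trans (hB0 k ω)))
  have hNint : Integrable (N.indicator fun _ => (1 : ℝ)) μ :=
    (integrable_const 1).indicator (hle _ hNmeas)
  -- The second moment bound, integrated over an event of the past.
  have hsecond : ∀ k l, k ≤ l → ∀ s, MeasurableSet[ℱ k] s →
      ∫ ω in s, (G k ω - G l ω / C) ^ 2 ∂μ ≤ (1 - 1 / C) * ∫ ω in s, G k ω * G k ω ∂μ := by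
    intro k l hkl s hs
    have hcross : ∫ ω in s, G k ω * G l ω ∂μ = ∫ ω in s, G k ω * G k ω ∂μ := by
      rw [← setIntegral_condExp (ℱ.le k) (hGG k l) hs]
      refine setIntegral_congr_ae (ℱ.le k _ hs) ?_
      have h1 := condExp_mul_of_stronglyMeasurable_left (hG.stronglyMeasurable k) (hGG k l)
        (hG.integrable l)
      filter_upwards [h1, hG.condExp_ae_eq hkl] with ω h1 h2 _
      have h1' : (μ[fun ω => G k ω * G l ω | ℱ k]) ω = G k ω * (μ[G l | ℱ k]) ω := h1
      rw [h1', h2]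
    have hsq : ∫ ω in s, G l ω * G l ω ∂μ ≤ C * ∫ ω in s, G k ω * G k ω ∂μ := by
      calc ∫ ω in s, G l ω * G l ω ∂μ ≤ ∫ ω in s, F l ω ∂μ :=
            setIntegral_mono (hGG l l).integrableOn (hF.integrable l).integrableOn fun ω => by
              have := hGF l ω; rwa [sq] at this
        _ ≤ ∫ ω in s, F k ω ∂μ := hF.setIntegral_le hkl hs
        _ ≤ ∫ ω in s, C * (G k ω * G k ω) ∂μ :=
            setIntegral_mono (hF.integrable k).integrableOn
              ((hGG k k).const_mul C).integrableOn fun ω => by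
              have := hFG k ω; rwa [sq] at this
        _ = _ := integral_const_mul _ _
    have hexp : (fun ω => (G k ω - G l ω / C) ^ 2) = fun ω =>
        (G k ω * G k ω - 2 / C * (G k ω * G l ω)) + 1 / C ^ 2 * (G l ω * G l ω) := by
      funext ω; field_simp; ring
    have hsub : Integrable (fun ω => G k ω * G k ω - 2 / C * (G k ω * G l ω)) μ :=
      (hGG k k).sub ((hGG k l).const_mul _)
    rw [hexp, integral_add hsub.integrableOn
      ((hGG l l).const_mul _).integrableOn, integral_sub (hGG k k).integrableOn
      ((hGG k l).const_mul _).integrableOn, integral_const_mul, integral_const_mul, hcross]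
    have h3 : 1 / C ^ 2 * ∫ ω in s, G l ω * G l ω ∂μ ≤
        1 / C ^ 2 * (C * ∫ ω in s, G k ω * G k ω ∂μ) := by gcongr
    have h4 : 1 / C ^ 2 * (C * ∫ ω in s, G k ω * G k ω ∂μ) =
        1 / C * ∫ ω in s, G k ω * G k ω ∂μ := by field_simp
    rw [h4] at h3
    have h5 : 2 / C * ∫ ω in s, G k ω * G k ω ∂μ =
        1 / C * (∫ ω in s, G k ω * G k ω ∂μ) + 1 / C * ∫ ω in s, G k ω * G k ω ∂μ := by ring
    rw [h5]
    linarith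
  have hfatou : ∀ k s, MeasurableSet[ℱ k] s →
      ∫ ω in s, (G k ω * G k ω) * N.indicator (fun _ => (1 : ℝ)) ω ∂μ ≤
        (1 - 1 / C) * ∫ ω in s, G k ω * G k ω ∂μ := by
    intro k s hs
    have hlim : Tendsto (fun l => ∫ ω in s, min ((G k ω - G l ω / C) ^ 2) (G k ω * G k ω) *
        N.indicator (fun _ => (1 : ℝ)) ω ∂μ) atTop
        (𝓝 (∫ ω in s, (G k ω * G k ω) * N.indicator (fun _ => (1 : ℝ)) ω ∂μ)) := by
      refine tendsto_integral_of_dominated_convergence (fun ω => G k ω * G k ω) (fun l => ?_)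
        (hGG k k).integrableOn (fun l => ?_) ?_
      · refine StronglyMeasurable.aestronglyMeasurable ?_
        refine StronglyMeasurable.mul ?_ (stronglyMeasurable_const.indicator (hle _ hNmeas))
        exact (((hGsm k).sub ((hGsm l).measurable.div_const C).stronglyMeasurable).pow 2).inf ((hGsm k).mul (hGsm k))
      · refine Eventually.of_forall fun ω => ?_
        have h1 : 0 ≤ G k ω * G k ω := mul_self_nonneg _
        have h2 : 0 ≤ min ((G k ω - G l ω / C) ^ 2) (G k ω * G k ω) := le_min (sq_nonneg _) h1
        by_cases hω : ω ∈ N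
        · rw [Set.indicator_of_mem hω, mul_one, Real.norm_of_nonneg h2]
          exact min_le_right _ _
        · rw [Set.indicator_of_notMem hω, mul_zero, norm_zero]; exact h1
      · refine Eventually.of_forall fun ω => ?_
        by_cases hω : ω ∈ N
        · simp only [Set.indicator_of_mem hω, mul_one]
          have h1 : Tendsto (fun l => (G k ω - G l ω / C) ^ 2) atTop
              (𝓝 ((G k ω - 0 / C) ^ 2)) :=
            (tendsto_const_nhds.sub (Tendsto.div_const hω C)).pow 2
          have h2 := h1.min (tendsto_const_nhds (x := G k ω * G k ω))
          rw [zero_div, sub_zero, sq, min_self] at h2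
          simpa only [sq] using h2
        · simp only [Set.indicator_of_notMem hω, mul_zero]
          exact tendsto_const_nhds
    refine le_of_tendsto hlim ?_
    filter_upwards [eventually_ge_atTop k] with l hl
    refine le_trans ?_ (hsecond k l hl s hs)
    have hV : Integrable (fun ω => (G k ω - G l ω / C) ^ 2) μ := by
      have hexp : (fun ω => (G k ω - G l ω / C) ^ 2) = fun ω =>
          (G k ω * G k ω - 2 / C * (G k ω * G l ω)) + 1 / C ^ 2 * (G l ω * G l ω) := by
        funext ω; field_simp; ring
      rw [hexp]
      exact ((hGG k k).sub ((hGG k l).const_mul _)).add ((hGG l l).const_mul _)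
    refine integral_mono_of_nonneg (Eventually.of_forall fun ω => ?_) hV.integrableOn
      (Eventually.of_forall fun ω => ?_)
    · exact mul_nonneg (le_min (sq_nonneg _) (mul_self_nonneg _))
        (Set.indicator_nonneg (fun _ _ => zero_le_one) _)
    · by_cases hω : ω ∈ N
      · simp only [Set.indicator_of_mem hω, mul_one]; exact min_le_left _ _
      · simp only [Set.indicator_of_notMem hω, mul_zero]; exact sq_nonneg _
  have hcond : ∀ k, ∀ᵐ ω ∂μ, (μ[N.indicator fun _ => (1 : ℝ) | ℱ k]) ω ≤ 1 - 1 / C := by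
    intro k
    have hprod : Integrable (fun ω => (G k ω * G k ω) * N.indicator (fun _ => (1 : ℝ)) ω) μ := by
      have : (fun ω => (G k ω * G k ω) * N.indicator (fun _ => (1 : ℝ)) ω) =
          N.indicator fun ω => G k ω * G k ω := by
        funext ω; by_cases hω : ω ∈ N <;> simp [hω]
      rw [this]; exact (hGG k k).indicator (hle _ hNmeas)
    have hpull := condExp_mul_of_stronglyMeasurable_left
      ((hG.stronglyMeasurable k).mul (hG.stronglyMeasurable k)) hprod hNint
    set h : Ω → ℝ := fun ω => (1 - 1 / C) * (G k ω * G k ω) -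
      (μ[fun ω => (G k ω * G k ω) * N.indicator (fun _ => (1 : ℝ)) ω | ℱ k]) ω with hh
    have hhsm : StronglyMeasurable[ℱ k] h :=
      (((hG.stronglyMeasurable k).mul (hG.stronglyMeasurable k)).const_mul _).sub
        stronglyMeasurable_condExp
    have hhint : Integrable h μ := ((hGG k k).const_mul _).sub integrable_condExp
    have hh0 : 0 ≤ᵐ[μ.trim (ℱ.le k)] h := by
      refine ae_nonneg_of_forall_setIntegral_nonneg (hhint.trim (ℱ.le k) hhsm) fun s hs _ => ?_
      rw [← setIntegral_trim (ℱ.le k) hhsm hs, hh,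
        integral_sub ((hGG k k).const_mul _).integrableOn integrable_condExp.integrableOn,
        setIntegral_condExp (ℱ.le k) hprod hs, integral_const_mul]
      linarith [hfatou k s hs]
    filter_upwards [ae_of_ae_trim (ℱ.le k) hh0, hpull] with ω h1 h2
    have h2' : (μ[fun ω => (G k ω * G k ω) * N.indicator (fun _ => (1 : ℝ)) ω | ℱ k]) ω =
      (G k ω * G k ω) * (μ[N.indicator fun _ => (1 : ℝ) | ℱ k]) ω := h2
    have h1' : 0 ≤ (1 - 1 / C) * (G k ω * G k ω) -
      (μ[fun ω => (G k ω * G k ω) * N.indicator (fun _ => (1 : ℝ)) ω | ℱ k]) ω := h1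
    rw [h2'] at h1'
    have := mul_pos (hpos k ω) (hpos k ω)
    refine le_of_mul_le_mul_left ?_ this
    linarith
  have hlevy := hNint.tendsto_ae_condExp
    (stronglyMeasurable_const.indicator hNmeas : StronglyMeasurable[⨆ n, ℱ n] _)
  filter_upwards [hlevy, ae_all_iff.2 hcond] with ω h1 h2 hω
  rw [Set.indicator_of_mem (show ω ∈ N from hω)] at h1
  have := le_of_tendsto' h1 h2
  have : 0 < 1 / C := by positivity
  linarith

end Martingale

/-! ### The martingales of the attachment model -/

section Measurability

variable {Ω : Type*} {m X : ℕ → Ω → ℕ}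

lemma measurable_history_m (i k : ℕ) : Measurable[history m X k] (m i) :=
  measurable_iff_comap_le.2 (le_sup_of_le_left (le_iSup
    (fun i => MeasurableSpace.comap (m i) (inferInstance : MeasurableSpace ℕ)) i))

lemma measurable_history_X {j k : ℕ} (hjk : j < k) : Measurable[history m X k] (X j) :=
  measurable_iff_comap_le.2 (le_sup_of_le_right (le_iSup₂_of_le
    (f := fun j (_ : j < k) => MeasurableSpace.comap (X j) (inferInstance : MeasurableSpace ℕ))
    j hjk le_rfl))

lemma history_mono {k l : ℕ} (hkl : k ≤ l) : history m X k ≤ history m X l :=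
  sup_le_sup_left (iSup_mono fun _ => iSup_const_mono fun hj => hj.trans_le hkl) _

lemma measurable_edgeTotal (n k : ℕ) :
    Measurable[history m X k] fun ω => edgeTotal (fun i => m i ω) n :=
  Finset.measurable_fun_sum _ fun i _ => measurable_history_m i k

lemma measurable_newest (hm : ∀ i ω, 1 ≤ m i ω) (l k : ℕ) :
    Measurable[history m X k] fun ω => newest (fun i => m i ω) l := by
  refine measurable_of_Iic fun n => ?_
  have : (fun ω => newest (fun i => m i ω) l) ⁻¹' Set.Iic n =
      (fun ω => edgeTotal (fun i => m i ω) n) ⁻¹' Set.Ici l := by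
    ext ω
    exact newest_le_iff fun i => hm i ω
  rw [this]
  exact measurable_edgeTotal n k measurableSet_Ici

lemma measurable_deg (hm : ∀ i ω, 1 ≤ m i ω) (v : ℕ) {j k : ℕ} (hjk : j ≤ k) :
    Measurable[history m X k] fun ω => deg (fun i => m i ω) (fun l => X l ω) v j := by
  induction j with
  | zero => simp only [deg_zero]; exact measurable_const
  | succ j ih =>
    simp only [deg_succ]
    refine ((ih (by omega)).add ?_).add ?_
    · exact Measurable.ite (measurable_newest hm _ _ (measurableSet_singleton v))
        measurable_const measurable_const
    · exact Measurable.ite (measurable_history_X (by omega) (measurableSet_singleton v))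
        measurable_const measurable_const

lemma measurable_comp_deg (hm : ∀ i ω, 1 ≤ m i ω) (g : ℕ → ℝ) (v : ℕ) {j k : ℕ} (hjk : j ≤ k) :
    Measurable[history m X k] fun ω => g (deg (fun i => m i ω) (fun l => X l ω) v j) :=
  (measurable_of_countable g).comp (measurable_deg hm v hjk)

lemma measurable_totalWeight (hm : ∀ i ω, 1 ≤ m i ω) (f : ℕ → ℝ) {j k : ℕ} (hjk : j ≤ k) :
    Measurable[history m X k] fun ω => totalWeight f (fun i => m i ω) (fun l => X l ω) j := by
  have : (fun ω => totalWeight f (fun i => m i ω) (fun l => X l ω) j) = fun ω =>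
      ∑ v ∈ Finset.range (j + 1), if v < newest (fun i => m i ω) (j + 1) then
        f (deg (fun i => m i ω) (fun l => X l ω) v j) else 0 := by
    funext ω
    rw [totalWeight, ← Finset.sum_filter]
    refine Finset.sum_congr ?_ fun _ _ => rfl
    ext v
    have := newest_le (fun i => hm i ω) (j + 1)
    simp only [Finset.mem_range, Finset.mem_filter]
    omega
  rw [this]
  refine Finset.measurable_fun_sum _ fun v _ => ?_
  exact Measurable.ite (measurable_newest hm _ _ measurableSet_Ioi) (measurable_comp_deg hm f v hjk)
    measurable_const

lemma measurableSet_edgeTotal_le (n l k : ℕ) :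
    MeasurableSet[history m X k] {ω | edgeTotal (fun i => m i ω) n ≤ l} :=
  measurable_edgeTotal n k measurableSet_Iic

lemma measurable_fluct (hm : ∀ i ω, 1 ≤ m i ω) (f : ℕ → ℝ) (v k : ℕ) :
    Measurable[history m X k] fun ω => fluct f (fun i => m i ω) (fun l => X l ω) v k := by
  refine Finset.measurable_fun_sum _ fun l hl => ?_
  rw [Finset.mem_range] at hl
  refine Measurable.ite (measurableSet_edgeTotal_le _ _ _) (Measurable.sub ?_ ?_) measurable_const
  · exact Measurable.ite (measurable_history_X hl (measurableSet_singleton v))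
      (measurable_comp_deg hm (fun d => 1 / f d) v hl.le) measurable_const
  · exact measurable_const.div (measurable_totalWeight hm f hl.le)

lemma measurable_expFluct (hm : ∀ i ω, 1 ≤ m i ω) (f : ℕ → ℝ) (c : ℝ) (v k : ℕ) :
    Measurable[history m X k] fun ω => expFluct f c (fun i => m i ω) (fun l => X l ω) v k := by
  refine Finset.measurable_fun_prod _ fun l hl => ?_
  rw [Finset.mem_range] at hl
  refine Measurable.ite (measurableSet_edgeTotal_le _ _ _) (Measurable.div ?_ ?_) measurable_const
  · exact Measurable.ite (measurable_history_X hl (measurableSet_singleton v))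
      (measurable_comp_deg hm (fun d => 1 + c / f d) v hl.le) measurable_const
  · exact measurable_const.add (measurable_const.div (measurable_totalWeight hm f hl.le))

end Measurability

section

variable {Ω : Type*} [mΩ : MeasurableSpace Ω] {μ : Measure Ω}
  {f : ℕ → ℝ} {m X : ℕ → Ω → ℕ}

/-- The filtration of the histories `history m X (k + R)`, `k ≥ 0`, which starts at time `R`. -/
def IsAttachmentModel.filtration (h : IsAttachmentModel μ f m X) (R : ℕ) : Filtration ℕ mΩ where
  seq k := history m X (k + R)
  mono' _ _ hkl := history_mono (Nat.add_le_add_right hkl R)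
  le' _ := sup_le (iSup_le fun i => measurable_iff_comap_le.1 (h.measurable_m i))
    (iSup₂_le fun j _ => measurable_iff_comap_le.1 (h.measurable_X j))

lemma IsAttachmentModel.history_le (h : IsAttachmentModel μ f m X) (k : ℕ) :
    history m X k ≤ mΩ :=
  (h.filtration 0).le k

lemma attachProb_eq {m x : ℕ → ℕ} (hm : ∀ i, 1 ≤ m i) (k i : ℕ) : attachProb f m x k i =
    if edgeTotal m i ≤ k then f (deg m x i k) / totalWeight f m x k else 0 := by
  have : i < newest m (k + 1) ↔ edgeTotal m i ≤ k := by
    rw [lt_newest_iff hm, Nat.lt_succ_iff]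
  simp only [attachProb, this]
  rfl

lemma condExp_mul_attach [IsProbabilityMeasure μ] (h : IsAttachmentModel μ f m X) (k i : ℕ) {u : Ω → ℝ}
    (hu : Measurable[history m X k] u) {B : ℝ} (hB : ∀ ω, |u ω| ≤ B) :
    μ[fun ω => u ω * if X k ω = i then 1 else 0 | history m X k]
      =ᵐ[μ] fun ω => u ω * attachProb f (fun l => m l ω) (fun l => X l ω) k i := by
  have hs : MeasurableSet {ω | X k ω = i} := h.measurable_X k (measurableSet_singleton i)
  have hpull := condExp_stronglyMeasurable_mul_of_bound (μ := μ) (h.history_le k)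
    hu.stronglyMeasurable
    (((integrable_const (1 : ℝ)).indicator hs) : Integrable ({ω | X k ω = i}.indicator _) μ) B
    (Eventually.of_forall hB)
  have he : (fun ω => u ω * if X k ω = i then (1 : ℝ) else 0) =
      u * Set.indicator {ω | X k ω = i} (fun _ => (1 : ℝ)) := by
    funext ω
    simp only [Pi.mul_apply, Set.indicator_apply, Set.mem_ofPred_eq]
  rw [he]
  filter_upwards [hpull, h.condProb_attach k i] with ω h1 h2
  rw [h1, Pi.mul_apply, h2]

/-- The one-step conditional expectation of a quantity that takes one value if the `(k+1)`-th edge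
is attached to `v_i`, another if it is attached to `v_j`, and a third one otherwise. -/
lemma condExp_step [IsProbabilityMeasure μ] (h : IsAttachmentModel μ f m X) (k i j : ℕ) {r u w : Ω → ℝ}
    (hr : Measurable[history m X k] r) (hu : Measurable[history m X k] u)
    (hw : Measurable[history m X k] w) {Br Bu Bw : ℝ} (hBr : ∀ ω, |r ω| ≤ Br)
    (hBu : ∀ ω, |u ω| ≤ Bu) (hBw : ∀ ω, |w ω| ≤ Bw) :
    μ[fun ω => r ω + (u ω * if X k ω = i then 1 else 0) + (w ω * if X k ω = j then 1 else 0) |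
      history m X k] =ᵐ[μ] fun ω =>
        r ω + u ω * attachProb f (fun l => m l ω) (fun l => X l ω) k i +
          w ω * attachProb f (fun l => m l ω) (fun l => X l ω) k j := by
  have hle := h.history_le k
  have hrint : Integrable r μ :=
    Integrable.of_bound (hr.mono hle le_rfl).aestronglyMeasurable Br (Eventually.of_forall hBr)
  have hint : ∀ (i : ℕ) {u : Ω → ℝ} {B : ℝ}, Measurable[history m X k] u → (∀ ω, |u ω| ≤ B) →
      Integrable (fun ω => u ω * if X k ω = i then (1 : ℝ) else 0) μ := fun i u B hu hB => by
    refine Integrable.of_bound (Measurable.aestronglyMeasurable ?_) B (Eventually.of_forall ?_)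
    · exact (hu.mono hle le_rfl).mul (Measurable.ite
        (h.measurable_X k (measurableSet_singleton i)) measurable_const measurable_const)
    · intro ω
      have := hB ω
      have hB0 : 0 ≤ B := (abs_nonneg _).trans this
      split_ifs
      · simpa using this
      · simpa using hB0
  have h1 := condExp_add (hrint.add (hint i hu hBu)) (hint j hw hBw) (history m X k)
  have h2 := condExp_add hrint (hint i hu hBu) (history m X k)
  have h3 : μ[r | history m X k] = r :=
    condExp_of_stronglyMeasurable hle hr.stronglyMeasurable hrint
  refine EventuallyEq.trans h1 ?_
  filter_upwards [h2, condExp_mul_attach h k i hu hBu, condExp_mul_attach h k j hw hBw]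
    with ω e2 e3 e4
  rw [Pi.add_apply, e2, Pi.add_apply, h3, e3, e4]

lemma ae_attach_old [IsProbabilityMeasure μ] (h : IsAttachmentModel μ f m X) :
    ∀ᵐ ω ∂μ, ∀ k, X k ω < newest (fun l => m l ω) (k + 1) := by
  have key : ∀ k i, ∀ᵐ ω ∂μ, ¬ (newest (fun l => m l ω) (k + 1) ≤ i ∧ X k ω = i) := by
    intro k i
    have hle := h.history_le k
    set s : Set Ω := {ω | newest (fun l => m l ω) (k + 1) ≤ i}
    have hs : MeasurableSet[history m X k] s :=
      measurable_newest h.one_le_m _ _ measurableSet_Iic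
    have hX : MeasurableSet {ω | X k ω = i} := h.measurable_X k (measurableSet_singleton i)
    have hint : Integrable ({ω | X k ω = i}.indicator fun _ => (1 : ℝ)) μ :=
      (integrable_const 1).indicator hX
    have h1 := setIntegral_condExp hle hint hs
    have h2 : ∫ ω in s, (μ[Set.indicator {ω | X k ω = i} (fun _ => (1 : ℝ)) | history m X k]) ω ∂μ
        = 0 := by
      refine setIntegral_eq_zero_of_ae_eq_zero ?_
      filter_upwards [h.condProb_attach k i] with ω hω hωs
      rw [hω]
      exact if_neg (not_lt.2 hωs)
    rw [h2, integral_indicator hX, setIntegral_const, smul_eq_mul, mul_one,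
      measureReal_restrict_apply hX, eq_comm, measureReal_eq_zero_iff] at h1
    rw [ae_iff]
    convert h1 using 2
    ext ω
    simp only [not_not, Set.mem_ofPred_eq, Set.mem_inter_iff, s]
    tauto
  filter_upwards [ae_all_iff.2 fun k => ae_all_iff.2 (key k)] with ω hω k
  by_contra hcon
  exact hω k (X k ω) ⟨not_lt.1 hcon, rfl⟩

lemma martingale_fluct [IsProbabilityMeasure μ] (h : IsAttachmentModel μ f m X) (hf : ∀ i, 0 < f i) (hf_mono : Monotone f)
    (v : ℕ) :
    Martingale (fun k ω => fluct f (fun i => m i ω) (fun l => X l ω) v k) (h.filtration 0) μ := by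
  have hm : ∀ ω i, 1 ≤ m i ω := fun ω i => h.one_le_m i ω
  have h0 := one_div_pos.2 (hf 0)
  refine martingale_nat (fun k => (measurable_fluct h.one_le_m f v k).stronglyMeasurable)
    (fun k => Integrable.of_bound ((measurable_fluct h.one_le_m f v k).mono (h.history_le k)
      le_rfl).aestronglyMeasurable _ (Eventually.of_forall fun ω =>
        abs_fluct_le hf hf_mono (hm ω) v k)) fun k => ?_
  set r : Ω → ℝ := fun ω => fluct f (fun i => m i ω) (fun l => X l ω) v k +
    if edgeTotal (fun i => m i ω) v ≤ k then
      -(1 / totalWeight f (fun i => m i ω) (fun l => X l ω) k) else 0 with hr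
  set u : Ω → ℝ := fun ω => if edgeTotal (fun i => m i ω) v ≤ k then
      1 / f (deg (fun i => m i ω) (fun l => X l ω) v k) else 0 with hu
  have hrm : Measurable[history m X k] r := (measurable_fluct h.one_le_m f v k).add
    (Measurable.ite (measurableSet_edgeTotal_le _ _ _)
      (measurable_const.div (measurable_totalWeight h.one_le_m f le_rfl)).neg measurable_const)
  have hum : Measurable[history m X k] u := Measurable.ite (measurableSet_edgeTotal_le _ _ _)
    (measurable_comp_deg h.one_le_m (fun d => 1 / f d) v le_rfl) measurable_const
  have hrB : ∀ ω, |r ω| ≤ k * (1 / f 0) + 1 / f 0 := fun ω => by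
    refine (abs_add_le _ _).trans (add_le_add (abs_fluct_le hf hf_mono (hm ω) v k) ?_)
    obtain ⟨h1, h2⟩ := inv_totalWeight_mem (x := fun l => X l ω) hf hf_mono (hm ω) k
    split_ifs
    · rw [abs_neg, abs_of_pos h1]; exact h2
    · rw [abs_zero]; exact h0.le
  have huB : ∀ ω, |u ω| ≤ 1 / f 0 := fun ω => by
    obtain ⟨h1, h2⟩ := inv_f_mem hf hf_mono (deg (fun i => m i ω) (fun l => X l ω) v k)
    simp only [hu]
    split_ifs
    · rw [abs_of_pos h1]; exact h2
    · rw [abs_zero]; exact h0.le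
  have hstep := condExp_step h k v v hrm hum (measurable_const (a := (0 : ℝ))) hrB huB
    (Bw := 0) (fun _ => by simp)
  have he : (fun ω => fluct f (fun i => m i ω) (fun l => X l ω) v (k + 1)) = fun ω =>
      r ω + (u ω * if X k ω = v then 1 else 0) + (0 * if X k ω = v then 1 else 0) := by
    funext ω
    rw [fluct_succ, hr, hu]
    dsimp only
    split_ifs <;> ring
  rw [he]
  refine EventuallyEq.symm (hstep.trans (Eventually.of_forall fun ω => ?_))
  dsimp only
  rw [attachProb_eq (hm ω), hr, hu]
  dsimp only
  have h1 := hf (deg (fun i => m i ω) (fun l => X l ω) v k)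
  have h2 := totalWeight_pos (x := fun l => X l ω) hf hf_mono (hm ω) k
  split_ifs
  · field_simp; ring
  · ring

lemma martingale_expFluct [IsProbabilityMeasure μ] (h : IsAttachmentModel μ f m X) (hf : ∀ i, 0 < f i)
    (hf_mono : Monotone f) {c : ℝ} (hc : 0 < c) (v : ℕ) :
    Martingale (fun k ω => expFluct f c (fun i => m i ω) (fun l => X l ω) v k)
      (h.filtration 0) μ := by
  have hm : ∀ ω i, 1 ≤ m i ω := fun ω i => h.one_le_m i ω
  have h0 := hf 0
  have hbd : ∀ k ω, |expFluct f c (fun i => m i ω) (fun l => X l ω) v k| ≤ (1 + c / f 0) ^ k :=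
    fun k ω => by
      rw [abs_of_pos (expFluct_pos hf hc _ _ v k)]; exact expFluct_le hf hf_mono hc _ _ v k
  refine martingale_nat (fun k => (measurable_expFluct h.one_le_m f c v k).stronglyMeasurable)
    (fun k => Integrable.of_bound ((measurable_expFluct h.one_le_m f c v k).mono (h.history_le k)
      le_rfl).aestronglyMeasurable _ (Eventually.of_forall fun ω => hbd k ω)) fun k => ?_
  set r : Ω → ℝ := fun ω => expFluct f c (fun i => m i ω) (fun l => X l ω) v k *
    if edgeTotal (fun i => m i ω) v ≤ k then
      1 / (1 + c / totalWeight f (fun i => m i ω) (fun l => X l ω) k) else 1 with hr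
  set u : Ω → ℝ := fun ω => expFluct f c (fun i => m i ω) (fun l => X l ω) v k *
    if edgeTotal (fun i => m i ω) v ≤ k then
      c / f (deg (fun i => m i ω) (fun l => X l ω) v k) /
        (1 + c / totalWeight f (fun i => m i ω) (fun l => X l ω) k) else 0 with hu
  have hden : Measurable[history m X k] fun ω =>
      1 + c / totalWeight f (fun i => m i ω) (fun l => X l ω) k :=
    measurable_const.add (measurable_const.div (measurable_totalWeight h.one_le_m f le_rfl))
  have hden1 : ∀ ω, 1 ≤ 1 + c / totalWeight f (fun i => m i ω) (fun l => X l ω) k := fun ω => by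
    have := totalWeight_pos (x := fun l => X l ω) hf hf_mono (hm ω) k
    have : 0 < c / totalWeight f (fun i => m i ω) (fun l => X l ω) k := by positivity
    linarith
  have hrm : Measurable[history m X k] r := (measurable_expFluct h.one_le_m f c v k).mul
    (Measurable.ite (measurableSet_edgeTotal_le _ _ _) (measurable_const.div hden)
      measurable_const)
  have hum : Measurable[history m X k] u := (measurable_expFluct h.one_le_m f c v k).mul
    (Measurable.ite (measurableSet_edgeTotal_le _ _ _)
      ((measurable_comp_deg h.one_le_m (fun d => c / f d) v le_rfl).div hden) measurable_const)
  have hrB : ∀ ω, |r ω| ≤ (1 + c / f 0) ^ k * 1 := fun ω => by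
    rw [hr, abs_mul]
    refine mul_le_mul (hbd k ω) ?_ (abs_nonneg _) (by positivity)
    have h1 := hden1 ω
    split_ifs
    · rw [abs_of_pos (by positivity), div_le_one (by positivity)]; exact h1
    · simp
  have huB : ∀ ω, |u ω| ≤ (1 + c / f 0) ^ k * (c / f 0) := fun ω => by
    rw [hu, abs_mul]
    refine mul_le_mul (hbd k ω) ?_ (abs_nonneg _) (by positivity)
    have h1 := hden1 ω
    have h2 := hf (deg (fun i => m i ω) (fun l => X l ω) v k)
    split_ifs
    · rw [abs_of_pos (by positivity)]
      refine (div_le_self (by positivity) h1).trans ?_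
      gcongr
      exact hf_mono (Nat.zero_le _)
    · rw [abs_zero]; positivity
  have hstep := condExp_step h k v v hrm hum (measurable_const (a := (0 : ℝ))) hrB huB
    (Bw := 0) (fun _ => by simp)
  have he : (fun ω => expFluct f c (fun i => m i ω) (fun l => X l ω) v (k + 1)) = fun ω =>
      r ω + (u ω * if X k ω = v then 1 else 0) + (0 * if X k ω = v then 1 else 0) := by
    funext ω
    rw [expFluct_succ, hr, hu]
    dsimp only
    split_ifs <;> ring
  rw [he]
  refine EventuallyEq.symm (hstep.trans (Eventually.of_forall fun ω => ?_))
  dsimp only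
  rw [attachProb_eq (hm ω), hr, hu]
  dsimp only
  have h1 := hf (deg (fun i => m i ω) (fun l => X l ω) v k)
  have h2 := totalWeight_pos (x := fun l => X l ω) hf hf_mono (hm ω) k
  split_ifs
  · field_simp; ring
  · ring

/-- The squared increments of `fluct` are compensated by the increments of `Φ₂` of the degree,
which are summable. -/
lemma supermartingale_sq_fluct [IsProbabilityMeasure μ] (h : IsAttachmentModel μ f m X) (hf : ∀ i, 0 < f i)
    (hf_mono : Monotone f) {L : ℝ} (hL : Tendsto (Phi f 2) atTop (𝓝 L)) (v : ℕ) :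
    Supermartingale (fun k ω => fluct f (fun i => m i ω) (fun l => X l ω) v k ^ 2 -
      Phi f 2 (deg (fun i => m i ω) (fun l => X l ω) v k)) (h.filtration 0) μ := by
  have hm : ∀ ω i, 1 ≤ m i ω := fun ω i => h.one_le_m i ω
  have h0 := one_div_pos.2 (hf 0)
  have hmeas : ∀ k, Measurable[history m X k] fun ω =>
      fluct f (fun i => m i ω) (fun l => X l ω) v k ^ 2 -
        Phi f 2 (deg (fun i => m i ω) (fun l => X l ω) v k) := fun k =>
    ((measurable_fluct h.one_le_m f v k).pow_const 2).sub
      (measurable_comp_deg h.one_le_m (Phi f 2) v le_rfl)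
  have hPhi : ∀ d, |Phi f 2 d| ≤ L := fun d => by
    rw [abs_of_nonneg (Phi_nonneg hf 2 d)]; exact Phi_le_limit hf hL d
  have hsq : ∀ {a b : ℝ}, |a| ≤ b → |a ^ 2| ≤ b ^ 2 := fun {a b} hab => by
    rw [abs_pow]; gcongr
  refine supermartingale_nat (fun k => (hmeas k).stronglyMeasurable)
    (fun k => Integrable.of_bound ((hmeas k).mono (h.history_le k) le_rfl).aestronglyMeasurable
      ((k * (1 / f 0)) ^ 2 + L) (Eventually.of_forall fun ω =>
        (abs_sub _ _).trans (add_le_add (hsq (abs_fluct_le hf hf_mono (hm ω) v k)) (hPhi _))))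
    fun k => ?_
  -- At time `k + 1`, the value of `fluct` is `a + b` if `X k = v`, and `a` otherwise; likewise the
  -- degree is `d + 1` or `d`.
  set a : Ω → ℝ := fun ω => fluct f (fun i => m i ω) (fun l => X l ω) v k +
    if edgeTotal (fun i => m i ω) v ≤ k then
      -(1 / totalWeight f (fun i => m i ω) (fun l => X l ω) k) else 0 with ha
  set b : Ω → ℝ := fun ω => if edgeTotal (fun i => m i ω) v ≤ k then
      1 / f (deg (fun i => m i ω) (fun l => X l ω) v k) else 0 with hb
  set d : Ω → ℕ := fun ω => deg (fun i => m i ω) (fun l => X l ω) v k +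
    (if newest (fun i => m i ω) (k + 1) = v then 1 else 0) with hd
  have ham : Measurable[history m X k] a := (measurable_fluct h.one_le_m f v k).add
    (Measurable.ite (measurableSet_edgeTotal_le _ _ _)
      (measurable_const.div (measurable_totalWeight h.one_le_m f le_rfl)).neg measurable_const)
  have hbm : Measurable[history m X k] b := Measurable.ite (measurableSet_edgeTotal_le _ _ _)
    (measurable_comp_deg h.one_le_m (fun d => 1 / f d) v le_rfl) measurable_const
  have hdm : Measurable[history m X k] d := (measurable_deg h.one_le_m v le_rfl).add
    (Measurable.ite (measurable_newest h.one_le_m _ _ (measurableSet_singleton v))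
      measurable_const measurable_const)
  have hPm : ∀ g : ℕ → ℝ, Measurable[history m X k] fun ω => g (d ω) := fun g =>
    (measurable_of_countable g).comp hdm
  have haB : ∀ ω, |a ω| ≤ k * (1 / f 0) + 1 / f 0 := fun ω => by
    refine (abs_add_le _ _).trans (add_le_add (abs_fluct_le hf hf_mono (hm ω) v k) ?_)
    obtain ⟨h1, h2⟩ := inv_totalWeight_mem (x := fun l => X l ω) hf hf_mono (hm ω) k
    split_ifs
    · rw [abs_neg, abs_of_pos h1]; exact h2
    · rw [abs_zero]; exact h0.le
  have hbB : ∀ ω, |b ω| ≤ 1 / f 0 := fun ω => by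
    obtain ⟨h1, h2⟩ := inv_f_mem hf hf_mono (deg (fun i => m i ω) (fun l => X l ω) v k)
    simp only [hb]
    split_ifs
    · rw [abs_of_pos h1]; exact h2
    · rw [abs_zero]; exact h0.le
  set r : Ω → ℝ := fun ω => a ω ^ 2 - Phi f 2 (d ω) with hr
  set u : Ω → ℝ := fun ω => (a ω + b ω) ^ 2 - Phi f 2 (d ω + 1) - r ω with hu
  have hrm : Measurable[history m X k] r := (ham.pow_const 2).sub (hPm _)
  have hum : Measurable[history m X k] u :=
    (((ham.add hbm).pow_const 2).sub (hPm fun d => Phi f 2 (d + 1))).sub hrm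
  have hrB : ∀ ω, |r ω| ≤ (k * (1 / f 0) + 1 / f 0) ^ 2 + L := fun ω =>
    (abs_sub _ _).trans (add_le_add (hsq (haB ω)) (hPhi _))
  have huB : ∀ ω, |u ω| ≤ ((k * (1 / f 0) + 1 / f 0 + 1 / f 0) ^ 2 + L) +
      ((k * (1 / f 0) + 1 / f 0) ^ 2 + L) := fun ω =>
    (abs_sub _ _).trans (add_le_add ((abs_sub _ _).trans (add_le_add
      (hsq ((abs_add_le _ _).trans (add_le_add (haB ω) (hbB ω)))) (hPhi _))) (hrB ω))
  have hstep := condExp_step h k v v hrm hum (measurable_const (a := (0 : ℝ))) hrB huB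
    (Bw := 0) (fun _ => by simp)
  have he : (fun ω => fluct f (fun i => m i ω) (fun l => X l ω) v (k + 1) ^ 2 -
      Phi f 2 (deg (fun i => m i ω) (fun l => X l ω) v (k + 1))) = fun ω =>
      r ω + (u ω * if X k ω = v then 1 else 0) + (0 * if X k ω = v then 1 else 0) := by
    funext ω
    have hfl : fluct f (fun i => m i ω) (fun l => X l ω) v (k + 1) =
        a ω + if X k ω = v then b ω else 0 := by
      rw [fluct_succ, ha, hb]
      dsimp only
      split_ifs <;> ring
    have hde : deg (fun i => m i ω) (fun l => X l ω) v (k + 1) =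
        d ω + if X k ω = v then 1 else 0 := deg_succ _ _ _ _
    rw [hfl, hde, hu, hr]
    dsimp only
    split_ifs
    · ring
    · rw [add_zero, add_zero]; ring
  rw [he]
  refine EventuallyLE.trans hstep.le (Eventually.of_forall fun ω => ?_)
  dsimp only
  rw [attachProb_eq (hm ω), hu, hr]
  dsimp only
  have h1 := hf (deg (fun i => m i ω) (fun l => X l ω) v k)
  have h2 := totalWeight_pos (x := fun l => X l ω) hf hf_mono (hm ω) k
  by_cases hk : edgeTotal (fun i => m i ω) v ≤ k
  · have hdk : d ω = deg (fun i => m i ω) (fun l => X l ω) v k := by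
      have : v < newest (fun i => m i ω) (k + 1) := (lt_newest_iff (hm ω)).2 (by omega)
      rw [hd]; dsimp only; rw [if_neg this.ne', add_zero]
    rw [hdk, Phi_succ]
    simp only [ha, hb, if_pos hk]
    set M := fluct f (fun i => m i ω) (fun l => X l ω) v k
    set S := totalWeight f (fun i => m i ω) (fun l => X l ω) k
    set q := f (deg (fun i => m i ω) (fun l => X l ω) v k)
    set P := Phi f 2 (deg (fun i => m i ω) (fun l => X l ω) v k)
    have key : ((M + -(1 / S)) ^ 2 - P + ((M + -(1 / S) + 1 / q) ^ 2 - (P + 1 / q ^ 2) -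
        ((M + -(1 / S)) ^ 2 - P)) * (q / S) + 0 * (q / S)) = M ^ 2 - P - (1 / S) ^ 2 := by
      field_simp; ring
    rw [key]
    linarith [sq_nonneg (1 / S)]
  · simp only [if_neg hk, ha]
    have : Phi f 2 (deg (fun i => m i ω) (fun l => X l ω) v k) ≤ Phi f 2 (d ω) :=
      (Phi_strictMono hf 2).monotone (Nat.le_add_right _ _)
    rw [mul_zero, mul_zero, add_zero, add_zero, add_zero]
    linarith

/-- `Φ₁` of the degree of a fixed vertex follows the clock up to a convergent error. -/
lemma ae_tendsto_fluct [IsProbabilityMeasure μ] (h : IsAttachmentModel μ f m X) (hf : ∀ i, 0 < f i)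
    (hf_mono : Monotone f) {L : ℝ} (hL : Tendsto (Phi f 2) atTop (𝓝 L)) :
    ∀ᵐ ω ∂μ, ∀ v, ∃ c, Tendsto (fun k => fluct f (fun i => m i ω) (fun l => X l ω) v k)
      atTop (𝓝 c) := by
  rw [ae_all_iff]
  intro v
  have hM := martingale_fluct h hf hf_mono v
  have hS := supermartingale_sq_fluct h hf hf_mono hL v
  have hsqint : ∀ k, Integrable
      (fun ω => fluct f (fun i => m i ω) (fun l => X l ω) v k ^ 2) μ := fun k => by
    refine Integrable.of_bound (((measurable_fluct h.one_le_m f v k).pow_const 2).mono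
      (h.history_le k) le_rfl).aestronglyMeasurable ((k * (1 / f 0)) ^ 2)
      (Eventually.of_forall fun ω => ?_)
    rw [Real.norm_eq_abs, abs_pow]
    gcongr
    exact abs_fluct_le hf hf_mono (fun i => h.one_le_m i ω) v k
  have hPint : ∀ k, Integrable
      (fun ω => Phi f 2 (deg (fun i => m i ω) (fun l => X l ω) v k)) μ := fun k => by
    refine Integrable.of_bound ((measurable_comp_deg h.one_le_m (Phi f 2) v le_rfl).mono
      (h.history_le k) le_rfl).aestronglyMeasurable L (Eventually.of_forall fun ω => ?_)
    rw [Real.norm_eq_abs, abs_of_nonneg (Phi_nonneg hf 2 _)]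
    exact Phi_le_limit hf hL _
  refine ae_exists_tendsto_of_integral_sq_le hM hsqint (L := L) fun k => ?_
  have h1 := hS.setIntegral_le (Nat.zero_le k) MeasurableSet.univ
  simp only [setIntegral_univ] at h1
  rw [integral_sub (hsqint k) (hPint k)] at h1
  have h2 : ∫ ω, (fluct f (fun i => m i ω) (fun l => X l ω) v 0 ^ 2 -
      Phi f 2 (deg (fun i => m i ω) (fun l => X l ω) v 0)) ∂μ = 0 := by
    simp [fluct, deg_zero, Phi]
  have h3 : ∫ ω, Phi f 2 (deg (fun i => m i ω) (fun l => X l ω) v k) ∂μ ≤ L := by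
    calc _ ≤ ∫ _ω, L ∂μ := integral_mono (hPint k) (integrable_const L) fun ω =>
          Phi_le_limit hf hL _
      _ = L := by simp
  linarith

end

/-! ### Two vertices do not overtake each other infinitely often -/

section Potentials

/-- The square of the difference of `Φ₁` at the degrees `a` and `b` of two vertices, plus the part
of its quadratic variation still to come; `L` stands for `Φ₂(∞)`. Along the attachment process this is
a martingale. -/
noncomputable def quadPotential (f : ℕ → ℝ) (L : ℝ) (a b : ℕ) : ℝ :=
  (Phi f 1 a - Phi f 1 b) ^ 2 + ((L - Phi f 2 a) + (L - Phi f 2 b))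

/-- A quartic analogue of `quadPotential`, which is a supermartingale along the attachment process;
it lies between `quadPotential ^ 2` and `17 * quadPotential ^ 2`. -/
noncomputable def quartPotential (f : ℕ → ℝ) (L : ℝ) (a b : ℕ) : ℝ :=
  (Phi f 1 a - Phi f 1 b) ^ 4 +
    10 * (Phi f 1 a - Phi f 1 b) ^ 2 * ((L - Phi f 2 a) + (L - Phi f 2 b)) +
    17 * ((L - Phi f 2 a) + (L - Phi f 2 b)) ^ 2

variable {f : ℕ → ℝ} {L : ℝ}

lemma inv_sq_le_tail (hf : ∀ i, 0 < f i) (hL : Tendsto (Phi f 2) atTop (𝓝 L)) (a : ℕ) :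
    1 / f a ^ 2 ≤ L - Phi f 2 a := by
  have := Phi_le_limit hf hL (a + 1)
  rw [Phi_succ] at this
  linarith

lemma tail_pos (hf : ∀ i, 0 < f i) (hL : Tendsto (Phi f 2) atTop (𝓝 L)) (a : ℕ) :
    0 < L - Phi f 2 a := by
  have := inv_sq_le_tail hf hL a
  have h1 := hf a
  have : 0 < 1 / f a ^ 2 := by positivity
  linarith

lemma quadPotential_pos (hf : ∀ i, 0 < f i) (hL : Tendsto (Phi f 2) atTop (𝓝 L)) (a b : ℕ) :
    0 < quadPotential f L a b := by
  have h1 := tail_pos hf hL a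
  have h2 := tail_pos hf hL b
  rw [quadPotential]
  positivity

lemma quadPotential_sq_le (hf : ∀ i, 0 < f i) (hL : Tendsto (Phi f 2) atTop (𝓝 L)) (a b : ℕ) :
    quadPotential f L a b ^ 2 ≤ quartPotential f L a b := by
  have h1 := tail_pos hf hL a
  have h2 := tail_pos hf hL b
  rw [quadPotential, quartPotential]
  set D := Phi f 1 a - Phi f 1 b
  set v := (L - Phi f 2 a) + (L - Phi f 2 b)
  have hv : 0 < v := by positivity
  nlinarith [mul_nonneg (sq_nonneg D) hv.le, sq_nonneg v]

lemma quartPotential_le (hf : ∀ i, 0 < f i) (hL : Tendsto (Phi f 2) atTop (𝓝 L)) (a b : ℕ) :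
    quartPotential f L a b ≤ 17 * quadPotential f L a b ^ 2 := by
  have h1 := tail_pos hf hL a
  have h2 := tail_pos hf hL b
  rw [quadPotential, quartPotential]
  set D := Phi f 1 a - Phi f 1 b
  set v := (L - Phi f 2 a) + (L - Phi f 2 b)
  have hv : 0 < v := by positivity
  nlinarith [mul_nonneg (sq_nonneg D) hv.le, sq_nonneg (D ^ 2)]

lemma quadPotential_step (hf : ∀ i, 0 < f i) (a b : ℕ) :
    f a * (quadPotential f L (a + 1) b - quadPotential f L a b) +
      f b * (quadPotential f L a (b + 1) - quadPotential f L a b) = 0 := by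
  have h1 := hf a
  have h2 := hf b
  simp only [quadPotential, Phi_succ]
  field_simp
  ring

lemma quartic_increment_le {D v δ : ℝ} (h : δ ^ 2 ≤ v) :
    ((D + δ) ^ 4 + 10 * (D + δ) ^ 2 * (v - δ ^ 2) + 17 * (v - δ ^ 2) ^ 2) -
      (D ^ 4 + 10 * D ^ 2 * v + 17 * v ^ 2) ≤ δ * (4 * D ^ 3 + 20 * D * v) := by
  have h1 : 0 ≤ δ ^ 2 * (D + 2 * δ) ^ 2 := by positivity
  have h2 : 0 ≤ δ ^ 2 * (v - δ ^ 2) := mul_nonneg (sq_nonneg _) (by linarith)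
  nlinarith

lemma quartPotential_step (hf : ∀ i, 0 < f i) (hL : Tendsto (Phi f 2) atTop (𝓝 L)) (a b : ℕ) :
    f a * (quartPotential f L (a + 1) b - quartPotential f L a b) +
      f b * (quartPotential f L a (b + 1) - quartPotential f L a b) ≤ 0 := by
  have ha := hf a
  have hb := hf b
  simp only [quartPotential, Phi_succ, pow_one]
  set D := Phi f 1 a - Phi f 1 b with hD
  set v := (L - Phi f 2 a) + (L - Phi f 2 b) with hv
  have e1 : Phi f 1 a + 1 / f a - Phi f 1 b = D + 1 / f a := by rw [hD]; ring
  have e2 : Phi f 1 a - (Phi f 1 b + 1 / f b) = D + -(1 / f b) := by rw [hD]; ring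
  have e3 : L - (Phi f 2 a + 1 / f a ^ 2) + (L - Phi f 2 b) = v - (1 / f a) ^ 2 := by
    rw [hv]; ring
  have e4 : L - Phi f 2 a + (L - (Phi f 2 b + 1 / f b ^ 2)) = v - (-(1 / f b)) ^ 2 := by
    rw [hv]; ring
  have i1 : (1 / f a) ^ 2 ≤ v := by
    have := inv_sq_le_tail hf hL a
    have := tail_pos hf hL b
    rw [one_div_pow]; linarith
  have i2 : (-(1 / f b)) ^ 2 ≤ v := by
    have := inv_sq_le_tail hf hL b
    have := tail_pos hf hL a
    rw [neg_sq, one_div_pow]; linarith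
  rw [e1, e2, e3, e4]
  have k1 := mul_le_mul_of_nonneg_left (quartic_increment_le (D := D) i1) ha.le
  have k2 := mul_le_mul_of_nonneg_left (quartic_increment_le (D := D) i2) hb.le
  have l1 : f a * (1 / f a * (4 * D ^ 3 + 20 * D * v)) = 4 * D ^ 3 + 20 * D * v := by
    field_simp
  have l2 : f b * (-(1 / f b) * (4 * D ^ 3 + 20 * D * v)) = -(4 * D ^ 3 + 20 * D * v) := by
    field_simp
  rw [l1] at k1
  rw [l2] at k2
  linarith

end Potentials

section

variable {Ω : Type*} {m X : ℕ → Ω → ℕ}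

/-- The function `H` of the degrees of `v_i` and `v_j`, observed from time `R` on. It is only of
interest if both vertices have attached their edges by time `R`, and is set to `1` otherwise. -/
noncomputable def pairValue (m X : ℕ → Ω → ℕ) (i j R : ℕ) (H : ℕ → ℕ → ℝ) (k : ℕ) (ω : Ω) : ℝ :=
  if edgeTotal (fun l => m l ω) i ≤ R ∧ edgeTotal (fun l => m l ω) j ≤ R then
    H (deg (fun l => m l ω) (fun l => X l ω) i (k + R))
      (deg (fun l => m l ω) (fun l => X l ω) j (k + R)) else 1

lemma measurable_comp_deg₂ (hm : ∀ i ω, 1 ≤ m i ω) (H : ℕ → ℕ → ℝ) (i j R k : ℕ) :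
    Measurable[history m X k] fun ω =>
      if edgeTotal (fun l => m l ω) i ≤ R ∧ edgeTotal (fun l => m l ω) j ≤ R then
        H (deg (fun l => m l ω) (fun l => X l ω) i k)
          (deg (fun l => m l ω) (fun l => X l ω) j k) else 1 :=
  Measurable.ite ((measurableSet_edgeTotal_le i R k).inter (measurableSet_edgeTotal_le j R k))
    ((measurable_of_countable (fun p : ℕ × ℕ => H p.1 p.2)).comp
      ((measurable_deg hm i le_rfl).prodMk (measurable_deg hm j le_rfl))) measurable_const

lemma exists_bound_comp_deg (H : ℕ → ℕ → ℝ) (k : ℕ) : ∃ B, ∀ (m x : ℕ → ℕ) (i j : ℕ),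
    |H (deg m x i k) (deg m x j k)| ≤ B := by
  refine ⟨∑ p ∈ Finset.range (2 * k + 1) ×ˢ Finset.range (2 * k + 1), |H p.1 p.2|,
    fun m x i j => ?_⟩
  refine Finset.single_le_sum (f := fun p : ℕ × ℕ => |H p.1 p.2|) (fun _ _ => abs_nonneg _)
    (Finset.mem_product.2 ⟨?_, ?_⟩ : (deg m x i k, deg m x j k) ∈ _)
  · exact Finset.mem_range.2 (Nat.lt_succ_of_le (deg_le m x i k))
  · exact Finset.mem_range.2 (Nat.lt_succ_of_le (deg_le m x j k))

lemma exists_bound_pairValue (m X : ℕ → Ω → ℕ) (i j R : ℕ) (H : ℕ → ℕ → ℝ) (k : ℕ) :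
    ∃ B, ∀ ω, |pairValue m X i j R H k ω| ≤ B := by
  obtain ⟨B, hB⟩ := exists_bound_comp_deg H (k + R)
  refine ⟨max B 1, fun ω => ?_⟩
  rw [pairValue]
  split_ifs
  · exact (hB _ _ i j).trans (le_max_left _ _)
  · simp

end

section

variable {Ω : Type*} [mΩ : MeasurableSpace Ω] {μ : Measure Ω} [IsProbabilityMeasure μ]
  {f : ℕ → ℝ} {m X : ℕ → Ω → ℕ}

lemma integrable_pairValue (h : IsAttachmentModel μ f m X) (i j R : ℕ) (H : ℕ → ℕ → ℝ) (k : ℕ) :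
    Integrable (pairValue m X i j R H k) μ := by
  obtain ⟨B, hB⟩ := exists_bound_pairValue m X i j R H k
  exact Integrable.of_bound ((measurable_comp_deg₂ h.one_le_m H i j R (k + R)).mono
    (h.history_le _) le_rfl).aestronglyMeasurable B (Eventually.of_forall hB)

/-- The conditional drift of a function of two degrees. -/
lemma condExp_pairValue (h : IsAttachmentModel μ f m X) {i j : ℕ} (hij : i ≠ j) (R : ℕ)
    (H : ℕ → ℕ → ℝ) (k : ℕ) :
    μ[pairValue m X i j R H (k + 1) | history m X (k + R)] =ᵐ[μ] fun ω =>
      pairValue m X i j R H k ω +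
        (pairValue m X i j R (fun a b => f a * (H (a + 1) b - H a b) +
          f b * (H a (b + 1) - H a b)) k ω - pairValue m X i j R (fun _ _ => 0) k ω) /
          totalWeight f (fun l => m l ω) (fun l => X l ω) (k + R) := by
  have hm : ∀ ω i, 1 ≤ m i ω := fun ω i => h.one_le_m i ω
  have hmeas := fun H => measurable_comp_deg₂ (X := X) h.one_le_m H i j R (k + R)
  set r : Ω → ℝ := pairValue m X i j R H k with hr
  set u : Ω → ℝ := fun ω => pairValue m X i j R (fun a b => H (a + 1) b) k ω - r ω with hu
  set w : Ω → ℝ := fun ω => pairValue m X i j R (fun a b => H a (b + 1)) k ω - r ω with hw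
  obtain ⟨Br, hBr⟩ := exists_bound_pairValue m X i j R H k
  obtain ⟨Bu, hBu⟩ := exists_bound_pairValue m X i j R (fun a b => H (a + 1) b) k
  obtain ⟨Bw, hBw⟩ := exists_bound_pairValue m X i j R (fun a b => H a (b + 1)) k
  have hstep := condExp_step h (k + R) i j (hmeas H) ((hmeas fun a b => H (a + 1) b).sub (hmeas H))
    ((hmeas fun a b => H a (b + 1)).sub (hmeas H)) hBr
    (fun ω => (abs_sub _ _).trans (add_le_add (hBu ω) (hBr ω)))
    (fun ω => (abs_sub _ _).trans (add_le_add (hBw ω) (hBr ω)))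
  have he : pairValue m X i j R H (k + 1) = fun ω =>
      r ω + (u ω * if X (k + R) ω = i then 1 else 0) + (w ω * if X (k + R) ω = j then 1 else 0) := by
    funext ω
    simp only [hr, hu, hw, pairValue]
    by_cases hE : edgeTotal (fun l => m l ω) i ≤ R ∧ edgeTotal (fun l => m l ω) j ≤ R
    · simp only [if_pos hE]
      rw [show k + 1 + R = k + R + 1 by omega, deg_succ_of_le (hm ω) (hE.1.trans (by omega)),
        deg_succ_of_le (hm ω) (hE.2.trans (by omega))]
      by_cases hi : X (k + R) ω = i
      · have hj : X (k + R) ω ≠ j := fun hj => hij (hi.symm.trans hj)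
        simp only [if_pos hi, if_neg hj, add_zero]; ring
      · by_cases hj : X (k + R) ω = j
        · simp only [if_neg hi, if_pos hj, add_zero]; ring
        · simp only [if_neg hi, if_neg hj, add_zero]; ring
    · simp only [if_neg hE]; ring
  rw [he]
  refine EventuallyEq.trans hstep (Eventually.of_forall fun ω => ?_)
  change r ω + u ω * _ + w ω * _ = _
  dsimp only
  rw [attachProb_eq (hm ω), attachProb_eq (hm ω)]
  simp only [hr, hu, hw, pairValue]
  by_cases hE : edgeTotal (fun l => m l ω) i ≤ R ∧ edgeTotal (fun l => m l ω) j ≤ R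
  · simp only [if_pos hE, if_pos (hE.1.trans (by omega : R ≤ k + R)),
      if_pos (hE.2.trans (by omega : R ≤ k + R))]
    ring
  · simp only [if_neg hE]; ring

lemma martingale_quadPotential (h : IsAttachmentModel μ f m X) (hf : ∀ i, 0 < f i) (L : ℝ)
    {i j : ℕ} (hij : i ≠ j) (R : ℕ) :
    Martingale (pairValue m X i j R (quadPotential f L)) (h.filtration R) μ := by
  refine martingale_nat
    (fun k => (measurable_comp_deg₂ h.one_le_m _ i j R (k + R)).stronglyMeasurable)
    (fun k => integrable_pairValue h i j R _ k) fun k => ?_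
  refine EventuallyEq.symm ((condExp_pairValue h hij R _ k).trans
    (Eventually.of_forall fun ω => ?_))
  simp only [quadPotential_step hf, sub_self, zero_div, add_zero]

lemma supermartingale_quartPotential (h : IsAttachmentModel μ f m X) (hf : ∀ i, 0 < f i)
    {L : ℝ} (hL : Tendsto (Phi f 2) atTop (𝓝 L)) {i j : ℕ} (hij : i ≠ j) (R : ℕ) :
    Supermartingale (pairValue m X i j R (quartPotential f L)) (h.filtration R) μ := by
  refine supermartingale_nat
    (fun k => (measurable_comp_deg₂ h.one_le_m _ i j R (k + R)).stronglyMeasurable)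
    (fun k => integrable_pairValue h i j R _ k) fun k => ?_
  refine EventuallyLE.trans (condExp_pairValue h hij R _ k).le
    (Eventually.of_forall fun ω => ?_)
  dsimp only
  have hS := zero_le_totalWeight hf (fun l => m l ω) (fun l => X l ω) (k + R)
  refine add_le_of_nonpos_right (div_nonpos_of_nonpos_of_nonneg ?_ hS)
  simp only [pairValue]
  split_ifs
  · rw [sub_zero]; exact quartPotential_step hf hL _ _
  · rw [sub_self]

lemma ae_not_tendsto_pairValue (h : IsAttachmentModel μ f m X) (hf : ∀ i, 0 < f i)
    {L : ℝ} (hL : Tendsto (Phi f 2) atTop (𝓝 L)) {i j : ℕ} (hij : i ≠ j) (R : ℕ) :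
    ∀ᵐ ω ∂μ, ¬ Tendsto
      (fun k => pairValue m X i j R (quadPotential f L) k ω) atTop (𝓝 0) := by
  have hpos : ∀ k ω, 0 < pairValue m X i j R (quadPotential f L) k ω := fun k ω => by
    rw [pairValue]
    split_ifs
    exacts [quadPotential_pos hf hL _ _, one_pos]
  have hGF : ∀ k ω, pairValue m X i j R (quadPotential f L) k ω ^ 2 ≤
      pairValue m X i j R (quartPotential f L) k ω := fun k ω => by
    rw [pairValue, pairValue]
    split_ifs
    exacts [quadPotential_sq_le hf hL _ _, by norm_num]
  have hFG : ∀ k ω, pairValue m X i j R (quartPotential f L) k ω ≤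
      17 * pairValue m X i j R (quadPotential f L) k ω ^ 2 := fun k ω => by
    rw [pairValue, pairValue]
    split_ifs
    exacts [quartPotential_le hf hL _ _, by norm_num]
  have hbdd : ∀ k, ∃ B, ∀ ω, pairValue m X i j R (quadPotential f L) k ω ≤ B := fun k => by
    obtain ⟨B, hB⟩ := exists_bound_pairValue m X i j R (quadPotential f L) k
    exact ⟨B, fun ω => (le_abs_self _).trans (hB ω)⟩
  exact ae_not_tendsto_zero_of_sq_le (by norm_num) (martingale_quadPotential h hf L hij R) hpos
    (supermartingale_quartPotential h hf hL hij R) hGF hFG hbdd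

lemma ae_not_tendsto_quadPotential (h : IsAttachmentModel μ f m X) (hf : ∀ i, 0 < f i)
    {L : ℝ} (hL : Tendsto (Phi f 2) atTop (𝓝 L)) :
    ∀ᵐ ω ∂μ, ∀ i j, i ≠ j → ¬ Tendsto (fun k => quadPotential f L
      (deg (fun l => m l ω) (fun l => X l ω) i k)
      (deg (fun l => m l ω) (fun l => X l ω) j k)) atTop (𝓝 0) := by
  have hall : ∀ᵐ ω ∂μ, ∀ i j R, i ≠ j → ¬ Tendsto
      (fun k => pairValue m X i j R (quadPotential f L) k ω) atTop (𝓝 0) := by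
    refine ae_all_iff.2 fun i => ae_all_iff.2 fun j => ae_all_iff.2 fun R => ?_
    by_cases hij : i = j
    · exact Eventually.of_forall fun ω hne => absurd hij hne
    · filter_upwards [ae_not_tendsto_pairValue h hf hL hij R] with ω hω _ using hω
  filter_upwards [hall] with ω hω i j hij hlim
  obtain ⟨R, hi, hj⟩ : ∃ R, edgeTotal (fun l => m l ω) i ≤ R ∧ edgeTotal (fun l => m l ω) j ≤ R :=
    ⟨_, le_max_left _ _, le_max_right _ _⟩
  refine hω i j R hij ?_
  have he : (fun k => pairValue m X i j R (quadPotential f L) k ω) = fun k => quadPotential f L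
      (deg (fun l => m l ω) (fun l => X l ω) i (k + R))
      (deg (fun l => m l ω) (fun l => X l ω) j (k + R)) :=
    funext fun k => if_pos ⟨hi, hj⟩
  rw [he]
  exact hlim.comp (tendsto_add_atTop_nat R)

/-- If the clock diverges, then all degrees diverge and, for each pair of vertices, one of the two
eventually has the strictly larger degree. -/
lemma eventually_deg_lt_or_lt {m x : ℕ → ℕ} (hf : ∀ i, 0 < f i) (hm : ∀ i, 1 ≤ m i)
    {L : ℝ} (hL : Tendsto (Phi f 2) atTop (𝓝 L)) (hclock : Tendsto (clock f m x) atTop atTop)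
    (hfluct : ∀ v, ∃ c, Tendsto (fluct f m x v) atTop (𝓝 c)) {i j : ℕ}
    (hG : ¬ Tendsto (fun k => quadPotential f L (deg m x i k) (deg m x j k)) atTop (𝓝 0)) :
    (∀ᶠ k in atTop, deg m x i k < deg m x j k) ∨ ∀ᶠ k in atTop, deg m x j k < deg m x i k := by
  have hlim : ∀ v, ∃ c, Tendsto (fun k => Phi f 1 (deg m x v k) - clock f m x k) atTop (𝓝 c) := by
    intro v
    obtain ⟨c, hc⟩ := hfluct v
    refine ⟨Phi f 1 (deg m x v (edgeTotal m v)) - clock f m x (edgeTotal m v) + c, ?_⟩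
    refine (tendsto_const_nhds.add hc).congr' ?_
    filter_upwards [eventually_ge_atTop (edgeTotal m v)] with k hk
    rw [Phi_deg hm hk]; ring
  have hdeg : ∀ v, Tendsto (deg m x v) atTop atTop := by
    intro v
    obtain ⟨c, hc⟩ := hlim v
    have h1 : Tendsto (fun k => Phi f 1 (deg m x v k)) atTop atTop :=
      (hc.add_atTop hclock).congr fun k => by ring
    refine tendsto_atTop.2 fun B => ?_
    filter_upwards [h1.eventually_ge_atTop (Phi f 1 B)] with k hk
    exact (Phi_strictMono hf 1).le_iff_le.1 hk
  have htail : ∀ v, Tendsto (fun k => L - Phi f 2 (deg m x v k)) atTop (𝓝 0) := fun v => by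
    simpa using (hL.comp (hdeg v)).const_sub L
  obtain ⟨ci, hci⟩ := hlim i
  obtain ⟨cj, hcj⟩ := hlim j
  have hD : Tendsto (fun k => Phi f 1 (deg m x i k) - Phi f 1 (deg m x j k)) atTop
      (𝓝 (ci - cj)) := (hci.sub hcj).congr fun k => by ring
  have hne : ci - cj ≠ 0 := by
    intro h0
    apply hG
    rw [h0] at hD
    have := (hD.pow 2).add ((htail i).add (htail j))
    simpa [quadPotential] using this
  rcases lt_or_gt_of_ne hne with h0 | h0
  · left
    filter_upwards [hD.eventually_lt_const h0] with k hk
    exact (Phi_strictMono hf 1).lt_iff_lt.1 (by linarith)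
  · right
    filter_upwards [hD.eventually_const_lt h0] with k hk
    exact (Phi_strictMono hf 1).lt_iff_lt.1 (by linarith)

/-- Among finitely many pairwise eventually ordered sequences, one is eventually maximal. -/
lemma exists_eventually_max {d : ℕ → ℕ → ℕ} {N : ℕ} (hN : 0 < N)
    (h : ∀ i j, i ≠ j → (∀ᶠ k in atTop, d i k < d j k) ∨ ∀ᶠ k in atTop, d j k < d i k) :
    ∃ v < N, ∀ᶠ k in atTop, ∀ w < N, d w k ≤ d v k := by
  induction N, hN using Nat.le_induction with
  | base =>
    refine ⟨0, one_pos, Eventually.of_forall fun k w hw => ?_⟩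
    rw [Nat.lt_one_iff.1 hw]
  | succ N _ ih =>
    obtain ⟨v, hv, hmax⟩ := ih
    rcases h v N hv.ne with h1 | h1
    · refine ⟨N, Nat.lt_succ_self N, ?_⟩
      filter_upwards [hmax, h1] with k h2 h3 w hw
      rcases Nat.lt_succ_iff_lt_or_eq.1 hw with hw | rfl
      · exact (h2 w hw).trans h3.le
      · exact le_rfl
    · refine ⟨v, hv.trans (Nat.lt_succ_self N), ?_⟩
      filter_upwards [hmax, h1] with k h2 h3 w hw
      rcases Nat.lt_succ_iff_lt_or_eq.1 hw with hw | rfl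
      · exact h2 w hw
      · exact h3.le

/-- A persistent hub emerges if all late vertices always have a degree smaller than that of
`v_0`. -/
lemma persistentHub_of_eventually_lt {m x : ℕ → ℕ} (hm : ∀ i, 1 ≤ m i)
    (hpair : ∀ i j, i ≠ j → (∀ᶠ k in atTop, deg m x i k < deg m x j k) ∨
      ∀ᶠ k in atTop, deg m x j k < deg m x i k)
    (hlate : ∀ᶠ n in atTop, ∀ k, n ≤ newest m k → deg m x n k < deg m x 0 k) :
    PersistentHub (edgeGraph m x) := by
  obtain ⟨N, hN⟩ := eventually_atTop.1 hlate
  obtain ⟨v, hv, hmax⟩ := exists_eventually_max (N := N + 1) (Nat.succ_pos N) hpair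
  obtain ⟨k₀, hk₀⟩ := eventually_atTop.1 hmax
  refine ⟨v, max k₀ (edgeTotal m v + 1), fun k hk => ⟨?_, fun w hw => ?_⟩⟩
  · have hv' := (le_max_right k₀ (edgeTotal m v + 1)).trans hk
    have : v < newest m k := (lt_newest_iff hm).2 (by omega)
    exact Finset.mem_range.2 (by omega)
  · have h0 := hk₀ k ((le_max_left _ _).trans hk)
    by_cases hwN : w < N + 1
    · exact h0 w hwN
    · have hw' : w ≤ newest m k := Nat.lt_succ_iff.1 (Finset.mem_range.1 hw)
      exact (hN w (by omega) k hw').le.trans (h0 0 (Nat.succ_pos N))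

end

/-! ### Late vertices against a fixed vertex -/

lemma tendsto_log_add_two : Tendsto (fun n : ℕ => Real.log ((n : ℝ) + 2)) atTop atTop :=
  Real.tendsto_log_atTop.comp (tendsto_atTop_add_const_right _ _ tendsto_natCast_atTop_atTop)

lemma log_add_two_pos (n : ℕ) : 0 < Real.log ((n : ℝ) + 2) :=
  Real.log_pos (by have : (0 : ℝ) ≤ n := Nat.cast_nonneg n; linarith)

section

variable {Ω : Type*} [mΩ : MeasurableSpace Ω] {μ : Measure Ω}
  {f : ℕ → ℝ} {m X : ℕ → Ω → ℕ}

lemma ae_eventually_notMem_of_le {s : ℕ → Set Ω}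
    (hs : ∀ᶠ n : ℕ in atTop, μ (s n) ≤ ENNReal.ofReal (1 / ((n : ℝ) + 2) ^ 2)) :
    ∀ᵐ ω ∂μ, ∀ᶠ n in atTop, ω ∉ s n := by
  obtain ⟨N, hN⟩ := eventually_atTop.1 hs
  have hsum : Summable fun n : ℕ => 1 / (((n + N : ℕ) : ℝ) + 2) ^ 2 := by
    have h1 : Summable fun n : ℕ => 1 / (n : ℝ) ^ 2 :=
      Real.summable_one_div_nat_pow.2 one_lt_two
    have h2 := (summable_nat_add_iff (N + 2)).2 h1
    refine h2.congr fun n => ?_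
    push_cast
    ring_nf
  have htsum : ∑' n, μ (s (n + N)) ≠ ⊤ := by
    refine ne_top_of_le_ne_top ?_ (ENNReal.tsum_le_tsum fun n => hN (n + N) (Nat.le_add_left N n))
    rw [← ENNReal.ofReal_tsum_of_nonneg (fun n => by positivity) hsum]
    exact ENNReal.ofReal_ne_top
  filter_upwards [ae_eventually_notMem htsum] with ω hω
  obtain ⟨M, hM⟩ := eventually_atTop.1 hω
  refine eventually_atTop.2 ⟨M + N, fun n hn => ?_⟩
  have := hM (n - N) (by omega)
  rwa [Nat.sub_add_cancel (by omega)] at this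

/-- Under the upper tail bound, the initial value `Φ₁(m_n)` is eventually below any given multiple
of `log n`. -/
lemma ae_eventually_Phi_le [IsProbabilityMeasure μ]
    (hm_ident : ∀ i, IdentDistrib (m i) (m 0) μ μ) {D z₀ θ : ℝ} (hD : 0 < D)
    (hθ : 1 < θ) (htail : ∀ z : ℝ, z₀ ≤ z →
      μ.real {ω | z < Phi f 1 (m 0 ω)} ≤ Real.exp (-D * z ^ θ)) {ε : ℝ} (hε : 0 < ε) :
    ∀ᵐ ω ∂μ, ∀ᶠ n : ℕ in atTop, Phi f 1 (m n ω) ≤ ε * Real.log ((n : ℝ) + 2) := by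
  have hlog := tendsto_log_add_two
  have hpow : ∀ᶠ n : ℕ in atTop, 2 / (D * ε ^ θ) ≤ Real.log ((n : ℝ) + 2) ^ (θ - 1) :=
    ((tendsto_rpow_atTop (by linarith)).comp hlog).eventually_ge_atTop _
  have hz : ∀ᶠ n : ℕ in atTop, z₀ ≤ ε * Real.log ((n : ℝ) + 2) :=
    (hlog.const_mul_atTop hε).eventually_ge_atTop _
  have hbc := ae_eventually_notMem_of_le (μ := μ)
    (s := fun n : ℕ => {ω | ε * Real.log ((n : ℝ) + 2) < Phi f 1 (m n ω)}) (by
      filter_upwards [hpow, hz] with n h1 h2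
      have hid : μ {ω | ε * Real.log ((n : ℝ) + 2) < Phi f 1 (m n ω)} =
          μ {ω | ε * Real.log ((n : ℝ) + 2) < Phi f 1 (m 0 ω)} :=
        (hm_ident n).measure_mem_eq
          (s := {d | ε * Real.log ((n : ℝ) + 2) < Phi f 1 d}) MeasurableSet.of_discrete
      rw [hid, ← ofReal_measureReal]
      refine ENNReal.ofReal_le_ofReal ((htail _ h2).trans ?_)
      set y := Real.log ((n : ℝ) + 2) with hy
      have hy0 : 0 < y := log_add_two_pos n
      have he : 1 / ((n : ℝ) + 2) ^ 2 = Real.exp (-(2 * y)) := by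
        rw [Real.exp_neg, two_mul, Real.exp_add, hy, Real.exp_log (by positivity), one_div, sq]
      rw [he, Real.exp_le_exp, neg_mul, neg_le_neg_iff, Real.mul_rpow hε.le hy0.le]
      have hsplit : y ^ θ = y ^ (θ - 1) * y := by
        rw [← Real.rpow_add_one hy0.ne']; congr 1; ring
      have hDε : 0 < D * ε ^ θ := mul_pos hD (Real.rpow_pos_of_pos hε θ)
      rw [div_le_iff₀ hDε] at h1
      rw [hsplit]
      nlinarith)
  filter_upwards [hbc] with ω hω
  filter_upwards [hω] with n hn
  exact not_lt.1 hn

/-- Under the lower tail bound, the initial value `Φ₁(m_n)` exceeds any given multiple of `log n`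
infinitely often. -/
lemma ae_frequently_lt_Phi [IsProbabilityMeasure μ] (hm_meas : ∀ i, Measurable (m i))
    (hm_indep : iIndepFun m μ)
    (hm_ident : ∀ i, IdentDistrib (m i) (m 0) μ μ) {D z₀ θ : ℝ} (hθ1 : θ < 1)
    (htail : ∀ z : ℝ, z₀ ≤ z →
      Real.exp (-D * z ^ θ) ≤ μ.real {ω | z < Phi f 1 (m 0 ω)}) {C : ℝ} (hC : 0 < C) :
    ∀ᵐ ω ∂μ, ∃ᶠ n : ℕ in atTop, C * Real.log ((n : ℝ) + 2) < Phi f 1 (m n ω) := by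
  set s : ℕ → Set Ω := fun n => {ω | C * Real.log ((n : ℝ) + 2) < Phi f 1 (m n ω)} with hs
  have hpre : ∀ n, s n = m n ⁻¹' {d | C * Real.log ((n : ℝ) + 2) < Phi f 1 d} := fun n => rfl
  have hsm : ∀ n, MeasurableSet (s n) := fun n => by
    rw [hpre]; exact hm_meas n MeasurableSet.of_discrete
  have hsi : iIndepSet s μ := by
    rw [iIndepSet_iff_meas_biInter hsm]
    intro S
    exact hm_indep.measure_inter_preimage_eq_mul S
      (sets := fun n => {d | C * Real.log ((n : ℝ) + 2) < Phi f 1 d})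
      fun _ _ => MeasurableSet.of_discrete
  have hlog := tendsto_log_add_two
  have hpow : ∀ᶠ n : ℕ in atTop, D * C ^ θ ≤ Real.log ((n : ℝ) + 2) ^ (1 - θ) :=
    ((tendsto_rpow_atTop (by linarith)).comp hlog).eventually_ge_atTop _
  have hz : ∀ᶠ n : ℕ in atTop, z₀ ≤ C * Real.log ((n : ℝ) + 2) :=
    (hlog.const_mul_atTop hC).eventually_ge_atTop _
  have hprob : ∀ᶠ n : ℕ in atTop, 1 / ((n : ℝ) + 2) ≤ (μ (s n)).toReal := by
    filter_upwards [hpow, hz] with n h1 h2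
    have hid : μ (s n) = μ {ω | C * Real.log ((n : ℝ) + 2) < Phi f 1 (m 0 ω)} :=
      (hm_ident n).measure_mem_eq
        (s := {d | C * Real.log ((n : ℝ) + 2) < Phi f 1 d}) MeasurableSet.of_discrete
    rw [hid]
    refine le_trans ?_ (htail _ h2)
    set y := Real.log ((n : ℝ) + 2) with hy
    have hy0 : 0 < y := log_add_two_pos n
    have he : 1 / ((n : ℝ) + 2) = Real.exp (-y) := by
      rw [Real.exp_neg, hy, Real.exp_log (by positivity), one_div]
    rw [he, Real.exp_le_exp, neg_mul, neg_le_neg_iff, Real.mul_rpow hC.le hy0.le]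
    have hsplit : y = y ^ (1 - θ) * y ^ θ := by
      rw [← Real.rpow_add hy0]; simp
    have := mul_le_mul_of_nonneg_right h1 (Real.rpow_pos_of_pos hy0 θ).le
    rw [← hsplit] at this
    linarith
  have htsum : ∑' n, μ (s n) = ⊤ := by
    by_contra hne
    have h1 := ENNReal.summable_toReal hne
    obtain ⟨N, hN⟩ := eventually_atTop.1 hprob
    have h2 : Summable fun n : ℕ => 1 / (((n + N : ℕ) : ℝ) + 2) :=
      Summable.of_nonneg_of_le (fun n => by positivity)
        (fun n => hN (n + N) (Nat.le_add_left N n)) ((summable_nat_add_iff N).2 h1)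
    refine Real.not_summable_one_div_natCast ((summable_nat_add_iff (N + 2)).1 (h2.congr fun n => ?_))
    push_cast
    ring_nf
  have hone := measure_limsup_eq_one hsm hsi htsum
  have hae : ∀ᵐ ω ∂μ, ω ∈ limsup s atTop :=
    (prob_compl_eq_zero_iff (MeasurableSet.measurableSet_limsup hsm)).2 hone
  filter_upwards [hae] with ω hω
  exact Filter.mem_limsup_iff_frequently_mem.1 hω

lemma ae_edgeTotal_le_linear (hm_indep : iIndepFun m μ)
    (hm_ident : ∀ i, IdentDistrib (m i) (m 0) μ μ) (hint : Integrable (fun ω => (m 0 ω : ℝ)) μ) :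
    ∀ᵐ ω ∂μ, ∃ K : ℝ, 0 ≤ K ∧ ∀ n : ℕ, (edgeTotal (fun i => m i ω) n : ℝ) ≤ K * n := by
  have hcast : Measurable (fun d : ℕ => (d : ℝ)) := measurable_of_countable _
  have hslln := strong_law_ae_real (fun i ω => (m i ω : ℝ)) hint
    (fun i j hij => ((hm_indep.indepFun hij).comp hcast hcast :))
    (fun i => (hm_ident i).comp hcast)
  filter_upwards [hslln] with ω hω
  obtain ⟨K, hK⟩ := hω.bddAbove_range
  refine ⟨max K 0, le_max_right _ _, fun n => ?_⟩
  have h1 := (hK ⟨n, rfl⟩).trans (le_max_left K 0)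
  rcases Nat.eq_zero_or_pos n with rfl | hn
  · simp [edgeTotal_zero]
  · have hn' : (0 : ℝ) < n := by exact_mod_cast hn
    dsimp only at h1
    rw [div_le_iff₀ hn'] at h1
    rw [edgeTotal]
    push_cast
    exact h1

theorem ae_not_persistentHub [IsProbabilityMeasure μ] (h : IsAttachmentModel μ f m X) (hf : ∀ i, 0 < f i)
    (hf_mono : Monotone f) {L : ℝ} (hL : Tendsto (Phi f 2) atTop (𝓝 L))
    (hm_indep : iIndepFun m μ) (hm_ident : ∀ i, IdentDistrib (m i) (m 0) μ μ)
    (hint : Integrable (fun ω => (m 0 ω : ℝ)) μ) {D z₀ θ : ℝ} (hθ1 : θ < 1)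
    (htail : ∀ z : ℝ, z₀ ≤ z → Real.exp (-D * z ^ θ) ≤ μ.real {ω | z < Phi f 1 (m 0 ω)}) :
    ∀ᵐ ω ∂μ, ¬ PersistentHub (vertexGraph (fun i => m i ω) (fun k => X k ω)) := by
  have hfreq : ∀ᵐ ω ∂μ, ∀ C : ℕ, ∃ᶠ n : ℕ in atTop,
      ((C : ℝ) + 1) * Real.log ((n : ℝ) + 2) < Phi f 1 (m n ω) := ae_all_iff.2 fun C =>
    ae_frequently_lt_Phi h.measurable_m hm_indep hm_ident hθ1 htail (by positivity)
  filter_upwards [hfreq, ae_edgeTotal_le_linear hm_indep hm_ident hint,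
    ae_tendsto_fluct h hf hf_mono hL, ae_attach_old h] with ω hfreq hlin hfluct hold
  rintro ⟨v, n₀, hub⟩
  have hm : ∀ i, 1 ≤ m i ω := fun i => h.one_le_m i ω
  obtain ⟨K, hK0, hK⟩ := hlin
  obtain ⟨c, hc⟩ := hfluct v
  obtain ⟨B, hB⟩ := hc.bddAbove_range
  have h0 := hf 0
  obtain ⟨C, hC⟩ := exists_nat_ge (1 / f 0 * K)
  set m' : ℕ → ℕ := fun i => m i ω
  set x : ℕ → ℕ := fun k => X k ω
  set A : ℝ := Phi f 1 (deg m' x v (edgeTotal m' v)) + B + 1 / f 0 * (K * 2)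
  have hlarge : ∀ᶠ n : ℕ in atTop, A ≤ Real.log ((n : ℝ) + 2) :=
    tendsto_log_add_two.eventually_ge_atTop A
  obtain ⟨n, hn, hnA, hnv, hn0⟩ := ((hfreq C).and_eventually (hlarge.and
    ((eventually_ge_atTop v).and (eventually_ge_atTop n₀)))).exists
  have hmax := (hub (n + 1) (by omega)).2 (n + 1) (by
    refine Finset.mem_range.2 ?_
    rw [newest_edgeTotal hm]
    exact Nat.lt_succ_self _)
  have hmax' : m n ω ≤ deg m' x v (edgeTotal m' (n + 1)) :=
    (deg_newborn (m := m') hm hold n).symm.le.trans hmax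
  have h1 : Phi f 1 (m n ω) ≤ Phi f 1 (deg m' x v (edgeTotal m' (n + 1))) :=
    (Phi_strictMono hf 1).monotone hmax'
  rw [Phi_deg hm (edgeTotal_mono m' (by omega : v ≤ n + 1))] at h1
  have h2 : fluct f m' x v (edgeTotal m' (n + 1)) ≤ B := hB ⟨_, rfl⟩
  have h3 : clock f m' x (edgeTotal m' (n + 1)) ≤
      1 / f 0 * (K * (2 + Real.log ((n + 1 : ℕ) : ℝ))) :=
    (clock_edgeTotal_le hf hf_mono hm _).trans (by gcongr; exact sum_div_le_log hK0 hK _)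
  have h4 : 0 ≤ clock f m' x (edgeTotal m' v) :=
    (clock_mono hf m' x (Nat.zero_le _)).trans_eq' (by simp [clock])
  have h5 : Real.log ((n + 1 : ℕ) : ℝ) ≤ Real.log ((n : ℝ) + 2) := by
    refine Real.log_le_log (by positivity) ?_
    push_cast; linarith
  have h6 : 1 / f 0 * (K * Real.log ((n + 1 : ℕ) : ℝ)) ≤ C * Real.log ((n : ℝ) + 2) := by
    rw [← mul_assoc]
    exact mul_le_mul hC h5 (Real.log_natCast_nonneg _) (Nat.cast_nonneg _)
  have h7 : 1 / f 0 * (K * (2 + Real.log ((n + 1 : ℕ) : ℝ))) =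
      1 / f 0 * (K * 2) + 1 / f 0 * (K * Real.log ((n + 1 : ℕ) : ℝ)) := by ring
  rw [h7] at h3
  rw [add_mul, one_mul] at hn
  linarith

/-- Uniformly in time, the fluctuations of all late vertices are smaller than a multiple of
`log n`, with a factor `2 / c` that can be chosen. -/
lemma ae_eventually_fluct_le [IsProbabilityMeasure μ] (h : IsAttachmentModel μ f m X)
    (hf : ∀ i, 0 < f i) (hf_mono : Monotone f) {L : ℝ} (hL : Tendsto (Phi f 2) atTop (𝓝 L))
    {c : ℝ} (hc : 0 < c) :
    ∀ᵐ ω ∂μ, ∀ᶠ v : ℕ in atTop, ∀ k, fluct f (fun i => m i ω) (fun l => X l ω) v k ≤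
      2 / c * Real.log ((v : ℝ) + 2) + c / 2 * L := by
  have hbc := ae_eventually_notMem_of_le (μ := μ) (s := fun v : ℕ => {ω | ∃ k,
    ((v : ℝ) + 2) ^ 2 ≤ expFluct f c (fun i => m i ω) (fun l => X l ω) v k})
    (Eventually.of_forall fun v => measure_exists_le_martingale
      (martingale_expFluct h hf hf_mono hc v) (fun k ω => (expFluct_pos hf hc _ _ v k).le)
      (fun ω => by simp [expFluct]) (by positivity))
  filter_upwards [hbc] with ω hω
  filter_upwards [hω] with v hv k
  have hlt : expFluct f c (fun i => m i ω) (fun l => X l ω) v k < ((v : ℝ) + 2) ^ 2 :=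
    not_le.1 fun hle => hv ⟨k, hle⟩
  have h1 := Real.log_le_log (expFluct_pos hf hc _ _ v k) hlt.le
  rw [Real.log_pow] at h1
  have h2 := fluct_le_log_expFluct hf hc (fun i => m i ω) (fun l => X l ω) v k
  have h3 : c ^ 2 / 2 * Phi f 2 (deg (fun i => m i ω) (fun l => X l ω) v k) ≤ c ^ 2 / 2 * L := by
    gcongr
    exact Phi_le_limit hf hL _
  refine le_of_mul_le_mul_left ?_ hc
  have e : c * (2 / c * Real.log ((v : ℝ) + 2) + c / 2 * L) =
      2 * Real.log ((v : ℝ) + 2) + c ^ 2 / 2 * L := by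
    field_simp
  rw [e]
  push_cast at h1
  linarith

lemma log_add_one_le_log_add (y : ℝ) (hy : 1 ≤ y) : Real.log (y + 1) ≤ Real.log y + 1 := by
  have h0 : 0 < y := by linarith
  have h1 : Real.log (y + 1) ≤ Real.log (y * 2) := Real.log_le_log (by linarith) (by linarith)
  rw [Real.log_mul h0.ne' two_ne_zero] at h1
  have := Real.log_two_lt_d9
  linarith

/-- If the clock is at least `c * log n` at the birth of `v_n`, whereas the initial value and the
fluctuations of `v_n` amount to at most a quarter of this each, then `v_n` never catches up with
`v_0`, provided that `n` is large. -/
lemma eventually_deg_lt_deg_zero {m x : ℕ → ℕ} (hf : ∀ i, 0 < f i) (hm : ∀ i, 1 ≤ m i)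
    (hold : ∀ k, x k < newest m (k + 1)) {c K : ℝ} (hc0 : 0 < c) (hK : 0 ≤ K)
    (hclog : ∀ k : ℕ, c * Real.log ((k : ℝ) + 1) ≤ clock f m x k)
    (hfluct : ∃ B, ∀ k, B ≤ fluct f m x 0 k)
    (hlate : ∀ᶠ v : ℕ in atTop, ∀ k, fluct f m x v k ≤ c / 4 * Real.log ((v : ℝ) + 2) + K)
    (hbirth : ∀ᶠ n : ℕ in atTop, Phi f 1 (m n) ≤ c / 4 * Real.log ((n : ℝ) + 2)) :
    ∀ᶠ n in atTop, ∀ k, n ≤ newest m k → deg m x n k < deg m x 0 k := by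
  obtain ⟨B, hB⟩ := hfluct
  have hroot : ∀ k, clock f m x k + B ≤ Phi f 1 (deg m x 0 k) := fun k => by
    have h1 := Phi_deg (f := f) (x := x) hm (v := 0) (k := k) (by simp [edgeTotal_zero])
    have h2 : B ≤ fluct f m x 0 k := hB k
    rw [h1, edgeTotal_zero, deg_zero, Phi_zero]
    simp only [clock, Finset.range_zero, Finset.sum_empty]
    linarith
  have hlarge : ∀ᶠ n : ℕ in atTop, c + c / 4 + K - B < c / 2 * Real.log ((n : ℝ) + 2) :=
    (tendsto_log_add_two.const_mul_atTop (by positivity)).eventually_gt_atTop _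
  have hsucc : ∀ᶠ n : ℕ in atTop, ∀ k, n + 1 ≤ newest m k →
      deg m x (n + 1) k < deg m x 0 k := by
    filter_upwards [(tendsto_add_atTop_nat 1).eventually hlate, hbirth, hlarge]
      with n hn1 hn2 hn3 k hk
    refine (Phi_strictMono hf 1).lt_iff_lt.1 ?_
    refine lt_of_lt_of_le ?_ (hroot k)
    have hlog0 := log_add_two_pos n
    rcases le_total (edgeTotal m (n + 1)) k with hk' | hk'
    · rw [Phi_deg hm hk', deg_newborn hm hold]
      have h1 := hn1 k
      have h2 := hclog (edgeTotal m (n + 1))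
      have h3 : Real.log ((n : ℝ) + 2) ≤ Real.log ((edgeTotal m (n + 1) : ℕ) + 1) := by
        refine Real.log_le_log (by positivity) ?_
        have : ((n + 1 : ℕ) : ℝ) ≤ (edgeTotal m (n + 1) : ℕ) := by
          exact_mod_cast le_edgeTotal hm (n + 1)
        push_cast at this
        linarith
      have h4 := mul_le_mul_of_nonneg_left h3 hc0.le
      have h5 : Real.log (((n + 1 : ℕ) : ℝ) + 2) ≤ Real.log ((n : ℝ) + 2) + 1 := by
        have := log_add_one_le_log_add ((n : ℝ) + 2)
          (by have : (0 : ℝ) ≤ n := Nat.cast_nonneg n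
              linarith)
        refine le_trans (le_of_eq ?_) this
        congr 1; push_cast; ring
      have h6 := mul_le_mul_of_nonneg_left h5 (by positivity : 0 ≤ c / 4)
      linarith
    · -- `v_{n+1}` is still attaching its edges, so its degree is at most `m_{n+1}`.
      have hkn : edgeTotal m n < k := (lt_newest_iff hm).1 (by omega)
      have h1 : Phi f 1 (deg m x (n + 1) k) ≤ Phi f 1 (m n) := by
        refine (Phi_strictMono hf 1).monotone ?_
        rw [← deg_newborn hm hold n]
        exact deg_mono m x _ hk'
      have h2 := hclog (edgeTotal m n)
      have h3 : Real.log ((n : ℝ) + 1) ≤ Real.log ((edgeTotal m n : ℕ) + 1) := by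
        refine Real.log_le_log (by positivity) ?_
        have : (n : ℝ) ≤ (edgeTotal m n : ℕ) := by exact_mod_cast le_edgeTotal hm n
        linarith
      have h4 : Real.log ((n : ℝ) + 2) ≤ Real.log ((n : ℝ) + 1) + 1 := by
        have := log_add_one_le_log_add ((n : ℝ) + 1)
          (by have : (0 : ℝ) ≤ n := Nat.cast_nonneg n
              linarith)
        refine le_trans (le_of_eq ?_) this
        congr 1; ring
      have h5 := mul_le_mul_of_nonneg_left (h4.trans (add_le_add_left h3 1)) hc0.le
      have h6 := clock_mono hf m x hkn.le
      have h9 := mul_pos hc0 hlog0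
      linarith
  obtain ⟨N, hN⟩ := eventually_atTop.1 hsucc
  refine eventually_atTop.2 ⟨N + 1, fun n hn => ?_⟩
  obtain ⟨n, rfl⟩ : ∃ n', n = n' + 1 := ⟨n - 1, by omega⟩
  exact hN n (by omega)

theorem ae_persistentHub [IsProbabilityMeasure μ] (h : IsAttachmentModel μ f m X)
    (hf : ∀ i, 0 < f i) (hf_mono : Monotone f) {L : ℝ} (hL : Tendsto (Phi f 2) atTop (𝓝 L))
    (hm_ident : ∀ i, IdentDistrib (m i) (m 0) μ μ) {Cf : ℝ} (hCf : 0 < Cf)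
    (hlin : ∀ i : ℕ, f i ≤ Cf * ((i : ℝ) + 1)) {D z₀ θ : ℝ} (hD : 0 < D) (hθ : 1 < θ)
    (htail : ∀ z : ℝ, z₀ ≤ z → μ.real {ω | z < Phi f 1 (m 0 ω)} ≤ Real.exp (-D * z ^ θ)) :
    ∀ᵐ ω ∂μ, PersistentHub (edgeGraph (fun i => m i ω) (fun k => X k ω)) := by
  set c : ℝ := 1 / (3 * Cf) with hc
  have hc0 : 0 < c := by positivity
  have hL0 : 0 ≤ L := (Phi_nonneg hf 2 0).trans (Phi_le_limit hf hL 0)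
  filter_upwards [ae_eventually_fluct_le h hf hf_mono hL (c := 8 / c) (by positivity),
    ae_eventually_Phi_le hm_ident hD hθ htail (ε := c / 4) (by positivity),
    ae_tendsto_fluct h hf hf_mono hL, ae_not_tendsto_quadPotential h hf hL, ae_attach_old h]
    with ω hlate hbirth hfluct hquad hold
  have hm : ∀ i, 1 ≤ m i ω := fun i => h.one_le_m i ω
  have hclog := fun k : ℕ => log_le_clock (x := fun l => X l ω) hf hf_mono hm hCf hlin k
  have hclock : Tendsto (clock f (fun i => m i ω) (fun l => X l ω)) atTop atTop := by
    refine tendsto_atTop_mono hclog (Tendsto.const_mul_atTop hc0 ?_)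
    exact Real.tendsto_log_atTop.comp
      (tendsto_atTop_add_const_right _ _ tendsto_natCast_atTop_atTop)
  obtain ⟨c₀, hc₀⟩ := hfluct 0
  obtain ⟨B, hB⟩ := hc₀.bddBelow_range
  -- The parameter `8 / c` of the product martingale makes the factor of `log n` equal to `c / 4`.
  rw [show 2 / (8 / c) = c / 4 by field_simp; norm_num] at hlate
  exact persistentHub_of_eventually_lt hm
    (fun i j hij => eventually_deg_lt_or_lt hf hm hL hclock hfluct (hquad i j hij))
    (eventually_deg_lt_deg_zero hf hm hold hc0 (by positivity) hclog
      ⟨B, fun k => hB ⟨k, rfl⟩⟩ hlate hbirth)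

end

end AttachmentModel

theorem theorem4p4 {Ω : Type*} [MeasurableSpace Ω] (μ : Measure Ω) [IsProbabilityMeasure μ]
    (f : ℕ → ℝ) (m X : ℕ → Ω → ℕ)
    (hf_pos : ∀ i, 0 < f i)
    (hf_mono : Monotone f)
    (hPhi1 : Tendsto (AttachmentModel.Phi f 1) atTop atTop)
    (hPhi2 : ∃ L : ℝ, Tendsto (AttachmentModel.Phi f 2) atTop (𝓝 L))
    (hmodel : AttachmentModel.IsAttachmentModel μ f m X)
    (hm_indep : iIndepFun m μ)
    (hm_ident : ∀ i, IdentDistrib (m i) (m 0) μ μ) :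
    ((∃ Cf : ℝ, 0 < Cf ∧ ∀ i : ℕ, f i ≤ Cf * ((i : ℝ) + 1)) →
      (∃ D z₀ θ : ℝ, 0 < D ∧ 0 < z₀ ∧ 1 < θ ∧ ∀ z : ℝ, z₀ ≤ z →
        μ.real {ω | z < AttachmentModel.Phi f 1 (m 0 ω)} ≤ Real.exp (-D * z ^ θ)) →
      (∀ᵐ ω ∂μ, AttachmentModel.PersistentHub
        (AttachmentModel.vertexGraph (fun i => m i ω) (fun k => X k ω))) ∧
      (∀ᵐ ω ∂μ, AttachmentModel.PersistentHub
        (AttachmentModel.edgeGraph (fun i => m i ω) (fun k => X k ω))))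
    ∧
    (Integrable (fun ω => (m 0 ω : ℝ)) μ →
      (∃ D' z₀' θ' : ℝ, 0 < D' ∧ 0 < z₀' ∧ 0 < θ' ∧ θ' < 1 ∧ ∀ z : ℝ, z₀' ≤ z →
        Real.exp (-D' * z ^ θ') ≤ μ.real {ω | z < AttachmentModel.Phi f 1 (m 0 ω)}) →
      (∀ᵐ ω ∂μ, ¬ AttachmentModel.PersistentHub
        (AttachmentModel.vertexGraph (fun i => m i ω) (fun k => X k ω))) ∧
      (∀ᵐ ω ∂μ, ¬ AttachmentModel.PersistentHub
        (AttachmentModel.edgeGraph (fun i => m i ω) (fun k => X k ω)))) := by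
  obtain ⟨L, hL⟩ := hPhi2
  refine ⟨?_, ?_⟩
  · rintro ⟨Cf, hCf, hlin⟩ ⟨D, z₀, θ, hD, -, hθ, htail⟩
    have hub := AttachmentModel.ae_persistentHub hmodel hf_pos hf_mono hL hm_ident hCf hlin hD hθ
      htail
    refine ⟨?_, hub⟩
    filter_upwards [hub] with ω hω
    exact hω.vertexGraph fun i => hmodel.one_le_m i ω
  · rintro hint ⟨D, z₀, θ, -, -, -, hθ, htail⟩
    have hno := AttachmentModel.ae_not_persistentHub hmodel hf_pos hf_mono hL hm_indep hm_ident
      hint hθ htail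
    refine ⟨hno, ?_⟩
    filter_upwards [hno] with ω hω hub
    exact hω (hub.vertexGraph fun i => hmodel.one_le_m i ω)
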